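/- Let $\theta$ be a permutation of $\{1,\dots,m\}\times\{1,\dots,n\}$ and let $\mathbb{F}_\theta^+$ be the unital semigroup generated by $e_1,\dots,e_m,f_1,\dots,f_n$ with the relations $e_if_j=f_{j'}e_{i'}$ for $\theta(i,j)=(i',j')$. For a word $u=i_1\cdots i_k$ put $e_u=e_{i_1}\cdots e_{i_k}$, and define $f_v$ likewise. A $*$-representation $\pi$ of $\mathbb{F}_\theta^+$ is a representation by isometries on a Hilbert space with $\sum_i\pi(e_i)\pi(e_i)^*=I=\sum_j\pi(f_j)\pi(f_j)^*$; it is atomic if there is an orthonormal basis which each $\pi(w)$ permutes up to scalars. Write $\dot\xi=\mathbb{C}\xi$ for a basis vector $\xi$; these lines are the vertices of the graph of $\pi$, whose blue (red) edges are $\dot\xi\to\pi(e_i)\dot\xi$ (respectively $\dot\xi\to\pi(f_j)\dot\xi$). An atomic $*$-representation $\pi$ is of type 3bii if its graph is connected, no blue component and no red component contains a ring (directed cycle), and there are a vertex $\dot\xi_0$ and $k,l\ge 1$ such that, pulling back from $\dot\xi_0$ along red edges, one returns to the blue component of $\dot\xi_0$ for the first time after $l$ steps, at a vertex $\dot\zeta_0$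 with $\pi(f_{v_0})\dot\zeta_0=\dot\xi_0=\pi(e_{u_0})\dot\zeta_0$ for some words $|u_0|=k$, $|v_0|=l$. The data of $\pi$ at such a $\dot\xi_0$ consist of the scalar $\beta\in\mathbb{T}$ with $\pi(f_{v_0})\zeta_0=\beta\,\pi(e_{u_0})\zeta_0$ and of the infinite tails $u_0u_{-1}u_{-2}\cdots$ and $v_0v_{-1}v_{-2}\cdots$, cut into blocks with $|u_d|=k$ and $|v_d|=l$, read when pulling back from $\dot\xi_0$ along the blue edges and along the red edges. (1) For every $\pi$ of type 3bii and every $\dot\xi_0,k,l$ as above, the data exist, are unique, and satisfy $$f_{v_{d+1}}e_{u_d}=e_{u_{d+1}}f_{v_d}\qquad\text{for } d<0 .\tag{$*$}$$ (2) The data determine $\pi$: two atomic $*$-representations of type 3bii having the same data $(k,l,\beta,(u_d),(v_d))$ (at some vertices) are unitarily equivalent. (3) Conversely, let $k,l\ge1$, $\beta\in\mathbb{T}$ and tails $(u_d)_{d\le0}$, $(v_d)_{d\le0}$ with blocks of lengths $k$ and $l$ satisfying $(*)$ be given. There is $R\ge0$ such that the pair $(u_{-R},v_{-R})$ equals $(u_{-r},v_{-r})$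 for some $r>R$. For every such $R$ there is a group construction representation $\sigma$ on $\ell^2(G)$, $G=\mathbb{Z}^2/\mathbb{Z}(k,-l)$, that is, a defect free representation (meaning $\sum_i\sigma(e_i)\sigma(e_i)^*=I=\sum_j\sigma(f_j)\sigma(f_j)^*$) of the form $$\sigma(e_i)\xi_g=\delta_{i\,i_g}\,\alpha_g\,\xi_{g+[1,0]},\qquad \sigma(f_j)\xi_g=\delta_{j\,j_g}\,\beta_g\,\xi_{g+[0,1]},$$ with $e_{i_{g+[0,1]}}f_{j_g}=f_{j_{g+[1,0]}}e_{i_g}$ and $\alpha_{g+[0,1]}\beta_g=\beta_{g+[1,0]}\alpha_g$ for all $g\in G$, in which the scalars are the constants $\alpha_g=1$ and $\beta_g=\beta_0$ with $\beta_0^{\,l}=\beta$, and whose tails obtained by pulling back from $\xi_{[-Rk,0]}=\xi_{[0,-Rl]}$ along the blue and red edges are $u_{-R}u_{-R-1}\cdots$ and $v_{-R}v_{-R-1}\cdots$. Moreover $\sigma$ has a minimal isometric dilation which is an atomic $*$-representation of type 3bii with exactly the given data $(k,l,\beta,(u_d)_{d\le 0},(v_d)_{d\le 0})$ at some vertex.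 -/

import Mathlib

open scoped ENNReal

noncomputable section

namespace RankTwo

/-! ### The semigroup -/

/-- The defining relations `e_i f_j = f_{j'} e_{i'}`, where `θ (i, j) = (i', j')`.  The generator
`e_i` is `Sum.inl i` and the generator `f_j` is `Sum.inr j`. -/
inductive Rel {m n : ℕ} (θ : Equiv.Perm (Fin m × Fin n)) :
    FreeMonoid (Fin m ⊕ Fin n) → FreeMonoid (Fin m ⊕ Fin n) → Prop
  | comm (i : Fin m) (j : Fin n) :
      Rel θ (FreeMonoid.of (Sum.inl i) * FreeMonoid.of (Sum.inr j))
        (FreeMonoid.of (Sum.inr (θ (i, j)).2) * FreeMonoid.of (Sum.inl (θ (i, j)).1))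

/-- The unital semigroup `𝔽_θ⁺` on `e_1, …, e_m, f_1, …, f_n`. -/
abbrev Semi {m n : ℕ} (θ : Equiv.Perm (Fin m × Fin n)) := PresentedMonoid (Rel θ)

section Words

variable {m n : ℕ} (θ : Equiv.Perm (Fin m × Fin n))

/-- The generator `e_i`. -/
def e (i : Fin m) : Semi θ := PresentedMonoid.of (Rel θ) (Sum.inl i)

/-- The generator `f_j`. -/
def f (j : Fin n) : Semi θ := PresentedMonoid.of (Rel θ) (Sum.inr j)

/-- The element `e_u = e_{u 0} e_{u 1} ⋯ e_{u (k-1)}`. -/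
def eWord {k : ℕ} (u : Fin k → Fin m) : Semi θ := (List.ofFn fun a => e θ (u a)).prod

/-- The element `f_v = f_{v 0} f_{v 1} ⋯ f_{v (l-1)}`. -/
def fWord {l : ℕ} (v : Fin l → Fin n) : Semi θ := (List.ofFn fun a => f θ (v a)).prod

end Words

/-! ### Representations -/

section Representations

variable {m n : ℕ} {θ : Equiv.Perm (Fin m × Fin n)}
variable {H : Type*} [NormedAddCommGroup H] [InnerProductSpace ℂ H]
variable {ι : Type*}

/-- `∑ π(e_i) π(e_i)^* = I = ∑ π(f_j) π(f_j)^*`. -/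
def IsDefectFree [CompleteSpace H] (π : Semi θ →* (H →L[ℂ] H)) : Prop :=
  (∑ i, π (e θ i) * ContinuousLinearMap.adjoint (π (e θ i)) = 1) ∧
    (∑ j, π (f θ j) * ContinuousLinearMap.adjoint (π (f θ j)) = 1)

/-- The range of `π` consists of isometries. -/
def IsIsometric (π : Semi θ →* (H →L[ℂ] H)) : Prop := ∀ w x, ‖π w x‖ = ‖x‖

/-- A `*`-representation: isometric and defect free. -/
def IsStarRep [CompleteSpace H] (π : Semi θ →* (H →L[ℂ] H)) : Prop :=
  IsIsometric π ∧ IsDefectFree π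

/-- The representation `π` is atomic with respect to the orthonormal basis `b`: it acts by partial
isometries, and each of them permutes the basis up to scalars in `𝕋 ∪ {0}`. -/
def IsAtomic [CompleteSpace H] (π : Semi θ →* (H →L[ℂ] H)) (b : HilbertBasis ι ℂ H) : Prop :=
  (∀ w, π w * ContinuousLinearMap.adjoint (π w) * π w = π w) ∧
    ∀ w x, ∃ y, ∃ c : ℂ, (‖c‖ = 1 ∨ c = 0) ∧ π w (b x) = c • b y

/-- `π(w)` carries the line `ℂ ξ_x` onto the line `ℂ ξ_y`.  The vertices of the graph of `π` are
the lines spanned by the basis vectors; they are represented here by their indices. -/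
def Carries (π : Semi θ →* (H →L[ℂ] H)) (b : HilbertBasis ι ℂ H) (w : Semi θ) (x y : ι) : Prop :=
  ∃ c : ℂ, c ≠ 0 ∧ π w (b x) = c • b y

/-- There is a blue edge from `x` to `y`. -/
def BlueEdge (π : Semi θ →* (H →L[ℂ] H)) (b : HilbertBasis ι ℂ H) (x y : ι) : Prop :=
  ∃ i, Carries π b (e θ i) x y

/-- There is a red edge from `x` to `y`. -/
def RedEdge (π : Semi θ →* (H →L[ℂ] H)) (b : HilbertBasis ι ℂ H) (x y : ι) : Prop :=
  ∃ j, Carries π b (f θ j) x y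

/-- The graph of `π` is connected (as an undirected graph). -/
def IsConnectedRep (π : Semi θ →* (H →L[ℂ] H)) (b : HilbertBasis ι ℂ H) : Prop :=
  Nonempty ι ∧
    ∀ x y, Relation.EqvGen (fun x y => BlueEdge π b x y ∨ RedEdge π b x y) x y

/-- `x` and `y` lie in the same blue component of the graph. -/
def SameBlue (π : Semi θ →* (H →L[ℂ] H)) (b : HilbertBasis ι ℂ H) (x y : ι) : Prop :=
  Relation.EqvGen (BlueEdge π b) x y

/-- Tail by tail type: all blue and all red components are of infinite tail type, that is, none of
them contains a ring (a directed cycle, which is a nonempty word fixing a vertex). -/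
def IsTailByTail (π : Semi θ →* (H →L[ℂ] H)) (b : HilbertBasis ι ℂ H) : Prop :=
  (∀ k : ℕ, 0 < k → ∀ (u : Fin k → Fin m) (x : ι), ¬ Carries π b (eWord θ u) x x) ∧
    (∀ l : ℕ, 0 < l → ∀ (v : Fin l → Fin n) (x : ι), ¬ Carries π b (fWord θ v) x x)

/-- Pulling back along the red edges from `x`, one returns to the blue component of `x` for the
first time after `l` steps. -/
def HasRedPeriod (π : Semi θ →* (H →L[ℂ] H)) (b : HilbertBasis ι ℂ H) (l : ℕ) (x : ι) : Prop :=
  IsLeast {t : ℕ | 0 < t ∧ ∃ (v : Fin t → Fin n) (z : ι),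
    Carries π b (fWord θ v) z x ∧ SameBlue π b z x} l

/-- Return above: the red period at `x` is `l`, and the vertex `z` obtained by pulling back `l` red
steps from `x` is also obtained by pulling back `k ≥ 1` blue steps from `x`. -/
def ReturnsAbove (π : Semi θ →* (H →L[ℂ] H)) (b : HilbertBasis ι ℂ H) (k l : ℕ) (x : ι) : Prop :=
  0 < k ∧ HasRedPeriod π b l x ∧
    ∃ (u : Fin k → Fin m) (v : Fin l → Fin n) (z : ι),
      Carries π b (eWord θ u) z x ∧ Carries π b (fWord θ v) z x

/-- `π` is an atomic `*`-representation (with basis `b`) of type 3bii with connected graph. -/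
structure IsType3bii [CompleteSpace H] (π : Semi θ →* (H →L[ℂ] H)) (b : HilbertBasis ι ℂ H) :
    Prop where
  starRep : IsStarRep π
  atomic : IsAtomic π b
  connected : IsConnectedRep π b
  tailByTail : IsTailByTail π b
  returnsAbove : ∃ (k l : ℕ) (x : ι), ReturnsAbove π b k l x

/-- Unitary equivalence of representations. -/
def UnitarilyEquivalent {H' : Type*} [NormedAddCommGroup H'] [InnerProductSpace ℂ H']
    (π : Semi θ →* (H →L[ℂ] H)) (π' : Semi θ →* (H' →L[ℂ] H')) : Prop :=
  ∃ U : H ≃ₗᵢ[ℂ] H', ∀ w x, U (π w x) = π' w (U x)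

/-- `π` is a minimal isometric dilation of `σ`, where the space of `σ` is identified with a
subspace of the space of `π` by the isometry `V`. -/
def IsMinimalIsometricDilation {H' : Type*} [NormedAddCommGroup H'] [InnerProductSpace ℂ H']
    [CompleteSpace H] [CompleteSpace H'] (σ : Semi θ →* (H →L[ℂ] H))
    (π : Semi θ →* (H' →L[ℂ] H')) (V : H →ₗᵢ[ℂ] H') : Prop :=
  IsIsometric π ∧
    (∀ w, ContinuousLinearMap.adjoint V.toContinuousLinearMap ∘L π w ∘L V.toContinuousLinearMap
      = σ w) ∧
    (Submodule.span ℂ {y : H' | ∃ w x, y = π w (V x)}).topologicalClosure = ⊤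

end Representations

/-! ### Tail data -/

/-- A scalar `β` and two infinite tails, cut into blocks of lengths `k` and `l`.  The block with
index `-r` in the tails `u_0 u_{-1} u_{-2} ⋯` and `v_0 v_{-1} v_{-2} ⋯` is `u r`, resp. `v r`. -/
structure TailData (m n k l : ℕ) where
  β : Circle
  u : ℕ → Fin k → Fin m
  v : ℕ → Fin l → Fin n

/-- The relations `f_{v_{d+1}} e_{u_d} = e_{u_{d+1}} f_{v_d}` for `d < 0` (here `d = -(r+1)`). -/
def TailData.Compatible {m n k l : ℕ} (T : TailData m n k l) (θ : Equiv.Perm (Fin m × Fin n)) :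
    Prop :=
  ∀ r : ℕ, fWord θ (T.v r) * eWord θ (T.u (r + 1)) = eWord θ (T.u r) * fWord θ (T.v (r + 1))

/-- `T` is the data of `π` at the vertex `x = ξ_{[0,0]}`, where `π` returns above: `p r` is the
vertex `ξ_{[-rk,0]}` obtained by pulling back `rk` blue steps from `x`, `q r` is the vertex
`ξ_{[0,-rl]}` obtained by pulling back `rl` red steps from `x`, and
`π(f_{v_0}) ξ_{[-k,0]} = β π(e_{u_0}) ξ_{[-k,0]}`. -/
def HasTailData {m n : ℕ} {θ : Equiv.Perm (Fin m × Fin n)} {H : Type*} [NormedAddCommGroup H]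
    [InnerProductSpace ℂ H] {ι : Type*} (π : Semi θ →* (H →L[ℂ] H)) (b : HilbertBasis ι ℂ H)
    {k l : ℕ} (x : ι) (T : TailData m n k l) : Prop :=
  ReturnsAbove π b k l x ∧
    ∃ p q : ℕ → ι, p 0 = x ∧ q 0 = x ∧
      (∀ r, Carries π b (eWord θ (T.u r)) (p (r + 1)) (p r)) ∧
      (∀ r, Carries π b (fWord θ (T.v r)) (q (r + 1)) (q r)) ∧
      π (fWord θ (T.v 0)) (b (p 1)) = (T.β : ℂ) • π (eWord θ (T.u 0)) (b (p 1))

/-! ### The group construction -/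

/-- The data of a group construction on an abelian group `G` with designated generators `g₁`,
`g₂`. -/
structure GroupConstruction {m n : ℕ} (θ : Equiv.Perm (Fin m × Fin n)) (G : Type*)
    [AddCommGroup G] (g₁ g₂ : G) where
  generate : AddSubgroup.closure {g₁, g₂} = ⊤
  i : G → Fin m
  j : G → Fin n
  α : G → Circle
  β : G → Circle
  comm_labels : ∀ g, e θ (i (g + g₂)) * f θ (j g) = f θ (j (g + g₁)) * e θ (i g)
  comm_scalars : ∀ g, α (g + g₂) * β g = β (g + g₁) * α g

/-- The Hilbert space `ℓ²(X)`. -/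
abbrev Ell2 (X : Type*) := lp (fun _ : X => ℂ) 2

open Classical in
/-- The standard basis vector `ξ_x` of `ℓ²(X)`. -/
def ξ {X : Type*} (x : X) : Ell2 X := lp.single 2 x 1

/-- `σ` is the group construction representation on `ℓ²(G)` with the data `D`:
`σ(e_i) ξ_g = δ_{i, i_g} α_g ξ_{g+g₁}` and `σ(f_j) ξ_g = δ_{j, j_g} β_g ξ_{g+g₂}`. -/
def GroupConstruction.IsRep {m n : ℕ} {θ : Equiv.Perm (Fin m × Fin n)} {G : Type*}
    [AddCommGroup G] {g₁ g₂ : G} (D : GroupConstruction θ G g₁ g₂)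
    (σ : Semi θ →* (Ell2 G →L[ℂ] Ell2 G)) : Prop :=
  (∀ i g, σ (e θ i) (ξ g) = if i = D.i g then (D.α g : ℂ) • ξ (g + g₁) else 0) ∧
    (∀ j g, σ (f θ j) (ξ g) = if j = D.j g then (D.β g : ℂ) • ξ (g + g₂) else 0)

/-- The group `ℤ² / ℤ(k, -l)`. -/
abbrev SpiralGroup (k l : ℕ) := (ℤ × ℤ) ⧸ AddSubgroup.zmultiples ((k : ℤ), -(l : ℤ))

/-- The class `[s, t]` in `ℤ² / ℤ(k, -l)`. -/
def cls (k l : ℕ) (s t : ℤ) : SpiralGroup k l := QuotientAddGroup.mk (s, t)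

/-- The group construction `D` continues the tails of `T` from their blocks with index `-R` on.
The scalars are the constants `1` and `β₀`, where `β₀ ^ l = β`.  The `a`-th letter of `u_{-r}`
labels the blue edge into `[-rk-a, 0]`, and the `a`-th letter of `v_{-r}` labels the red edge into
`[0, -rl-a]`; in `D`, edges are indexed by the vertices that they leave. -/
def Continues {m n k l : ℕ} {θ : Equiv.Perm (Fin m × Fin n)}
    (D : GroupConstruction θ (SpiralGroup k l) (cls k l 1 0) (cls k l 0 1))
    (T : TailData m n k l) (R : ℕ) : Prop :=
  (∀ g, D.α g = 1) ∧ (∃ β₀ : Circle, β₀ ^ l = T.β ∧ ∀ g, D.β g = β₀) ∧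
    (∀ r, R ≤ r → ∀ a : Fin k, D.i (cls k l (-((r : ℤ) * k) - ((a : ℕ) : ℤ) - 1) 0) = T.u r a) ∧
    (∀ r, R ≤ r → ∀ a : Fin l, D.j (cls k l 0 (-((r : ℤ) * l) - ((a : ℕ) : ℤ) - 1)) = T.v r a)

/-- The pair of blocks `(u_{-R}, v_{-R})` occurs again further down the tails. -/
def TailData.Recurs {m n k l : ℕ} (T : TailData m n k l) (R : ℕ) : Prop :=
  ∃ r, R < r ∧ T.u r = T.u R ∧ T.v r = T.v R

end RankTwo

end

/-!
An atomic `*`-representation permutes the lines spanned by its basis vectors.  Since it is isometric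
and defect free, this is an action of `𝔽_θ⁺` on the index set in which every vertex has exactly one
incoming blue and one incoming red edge (`exists_vertex_action`).  Everything is pulled back along
these edges, and by unique factorisation in `𝔽_θ⁺` a path into a given vertex is determined by its
degree (`smul_inj_of_deg`).

*Existence and uniqueness of the data.*  Pulling back in blocks of `k` blue or `l` red steps from a
vertex that returns above gives the two tails.  The two sides of each compatibility relation are
paths of the same degree into the same vertex, hence equal (`isTailPath_of_corners`).

*The data determine the representation.*  From the tails alone one builds a vertex space: pairs
`(w, r)`, standing for the vertex reached by `w` from the `r`-th corner of the tails, modulo the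
identifications by prolonging `w` with a blue or a red block (`TailSpace`).  The compatibility
relations make these identifications confluent.  Every representation of type 3bii with the given
data has its vertices in bijection with this space: if `w` and `w'` lead from the same corner to the
same vertex, then the absence of blue rings and the minimality of `l` force their degrees to differ
by a multiple of `(k, -l)` (`IsTailPath.deg_eq`), so that `w` and `w'` become equal after
prolongation by blocks.  Normalising the basis vectors along the corners shows that the letters
`e_i` act with scalar `1` and the letters `f_j` with a fixed `l`-th root `β₀` of `β`
(`IsType3bii.exists_tail_basis`).  So all such representations are unitarily equivalent to one
standard representation on `ℓ²` of the vertex space.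

*Existence.*  Conversely, the standard representation of compatible data is of type 3bii and has
these data.  That it has no rings and the correct red period is seen from the position of a vertex
in `ℤ² / ℤ(k, -l)`, which words move by their degree (`TailSpace.pos`).  By the pigeonhole principle
a pair of blocks recurs.  Repeating the blocks between two occurrences continues the corners
periodically in the other direction; these corners and all their predecessors form a copy of
`ℤ² / ℤ(k, -l)` in the vertex space (`TailSpace.exists_embedding`).  This copy is closed under
predecessors, so the compression of the standard representation to its span is multiplicative.  The
compression is the required group construction representation, and the standard representation is
its minimal isometric dilation (`exists_group_rep`).
-/

noncomputable section

namespace RankTwo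

/-! ### Degrees, normal forms and cancellation in the semigroup -/

section Semigroup

variable {m n : ℕ} {θ : Equiv.Perm (Fin m × Fin n)}

theorem e_mul_f (i : Fin m) (j : Fin n) :
    e θ i * f θ j = f θ (θ (i, j)).2 * e θ (θ (i, j)).1 :=
  PresentedMonoid.mk_eq_mk_of_rel (Rel.comm i j)

theorem f_mul_e (i : Fin m) (j : Fin n) :
    f θ j * e θ i = e θ (θ.symm (i, j)).1 * f θ (θ.symm (i, j)).2 := by
  rw [e_mul_f]; simp

theorem Semi.induction {P : Semi θ → Prop} (one : P 1) (e_mul : ∀ i w, P w → P (e θ i * w))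
    (f_mul : ∀ j w, P w → P (f θ j * w)) (w : Semi θ) : P w := by
  induction w using PresentedMonoid.inductionOn with
  | h a =>
    induction a using FreeMonoid.inductionOn' with
    | one => exact one
    | of_mul x xs ih =>
      rw [map_mul]
      cases x with
      | inl i => exact e_mul i _ ih
      | inr j => exact f_mul j _ ih

/-- The degree of an element of `𝔽_θ⁺`: the numbers of its blue and of its red letters. -/
def deg : Semi θ →* Multiplicative (ℕ × ℕ) :=
  PresentedMonoid.lift
    (fun x => Sum.elim (fun _ => Multiplicative.ofAdd (1, 0))
      (fun _ => Multiplicative.ofAdd (0, 1)) x)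
    (by rintro _ _ ⟨i, j⟩; simp [mul_comm])

/-- The number of blue letters of `w`. -/
def blueLen (w : Semi θ) : ℕ := (deg w).toAdd.1

/-- The number of red letters of `w`. -/
def redLen (w : Semi θ) : ℕ := (deg w).toAdd.2

@[simp] theorem blueLen_one : blueLen (1 : Semi θ) = 0 := by simp [blueLen]
@[simp] theorem redLen_one : redLen (1 : Semi θ) = 0 := by simp [redLen]
@[simp] theorem blueLen_mul (w w' : Semi θ) : blueLen (w * w') = blueLen w + blueLen w' := by
  simp [blueLen]
@[simp] theorem redLen_mul (w w' : Semi θ) : redLen (w * w') = redLen w + redLen w' := by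
  simp [redLen]
@[simp] theorem blueLen_e (i : Fin m) : blueLen (e θ i) = 1 := rfl
@[simp] theorem redLen_e (i : Fin m) : redLen (e θ i) = 0 := rfl
@[simp] theorem blueLen_f (j : Fin n) : blueLen (f θ j) = 0 := rfl
@[simp] theorem redLen_f (j : Fin n) : redLen (f θ j) = 1 := rfl

/-- The element `e_u` for a list `u` of letters. -/
def eList (θ : Equiv.Perm (Fin m × Fin n)) (u : List (Fin m)) : Semi θ := (u.map (e θ)).prod

/-- The element `f_v` for a list `v` of letters. -/
def fList (θ : Equiv.Perm (Fin m × Fin n)) (v : List (Fin n)) : Semi θ := (v.map (f θ)).prod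

@[simp] theorem eList_nil : eList θ [] = 1 := rfl
@[simp] theorem fList_nil : fList θ [] = 1 := rfl
@[simp] theorem eList_cons (i : Fin m) (u : List (Fin m)) :
    eList θ (i :: u) = e θ i * eList θ u := by simp [eList]
@[simp] theorem fList_cons (j : Fin n) (v : List (Fin n)) :
    fList θ (j :: v) = f θ j * fList θ v := by simp [fList]

theorem eWord_eq_eList {k : ℕ} (u : Fin k → Fin m) : eWord θ u = eList θ (List.ofFn u) := by
  simp [eWord, eList, List.map_ofFn, Function.comp_def]

theorem fWord_eq_fList {l : ℕ} (v : Fin l → Fin n) : fWord θ v = fList θ (List.ofFn v) := by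
  simp [fWord, fList, List.map_ofFn, Function.comp_def]

@[simp] theorem blueLen_eList (u : List (Fin m)) : blueLen (eList θ u) = u.length := by
  induction u with
  | nil => simp
  | cons i u ih => simp [ih, add_comm]

@[simp] theorem redLen_eList (u : List (Fin m)) : redLen (eList θ u) = 0 := by
  induction u with
  | nil => simp
  | cons i u ih => simp [ih]

@[simp] theorem blueLen_fList (v : List (Fin n)) : blueLen (fList θ v) = 0 := by
  induction v with
  | nil => simp
  | cons i u ih => simp [ih]

@[simp] theorem redLen_fList (v : List (Fin n)) : redLen (fList θ v) = v.length := by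
  induction v with
  | nil => simp
  | cons i u ih => simp [ih, add_comm]

@[simp] theorem blueLen_eWord {k : ℕ} (u : Fin k → Fin m) : blueLen (eWord θ u) = k := by
  simp [eWord_eq_eList]
@[simp] theorem redLen_eWord {k : ℕ} (u : Fin k → Fin m) : redLen (eWord θ u) = 0 := by
  simp [eWord_eq_eList]
@[simp] theorem blueLen_fWord {l : ℕ} (v : Fin l → Fin n) : blueLen (fWord θ v) = 0 := by
  simp [fWord_eq_fList]
@[simp] theorem redLen_fWord {l : ℕ} (v : Fin l → Fin n) : redLen (fWord θ v) = l := by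
  simp [fWord_eq_fList]

/-- Moving the red letter `j` through the blue word `u`: `f_j e_u = e_{u'} f_{j'}` for
`push θ j u = (u', j')`. -/
def push (θ : Equiv.Perm (Fin m × Fin n)) : Fin n → List (Fin m) → List (Fin m) × Fin n
  | j, [] => ([], j)
  | j, i :: u =>
    ((θ.symm (i, j)).1 :: (push θ (θ.symm (i, j)).2 u).1, (push θ (θ.symm (i, j)).2 u).2)

theorem f_mul_eList (j : Fin n) (u : List (Fin m)) :
    f θ j * eList θ u = eList θ (push θ j u).1 * f θ (push θ j u).2 := by
  induction u generalizing j with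
  | nil => simp [push]
  | cons i u ih => simp only [eList_cons, push]; rw [← mul_assoc, f_mul_e, mul_assoc, ih, mul_assoc]

theorem push_injective {j j' : Fin n} {u u' : List (Fin m)} (h : push θ j u = push θ j' u') :
    j = j' ∧ u = u' := by
  induction u generalizing j j' u' with
  | nil => cases u' <;> simp_all [push]
  | cons i u ih =>
    cases u' with
    | nil => simp [push] at h
    | cons i' u' =>
      simp only [push, Prod.mk.injEq, List.cons.injEq] at h
      obtain ⟨⟨h1, h2⟩, h3⟩ := h
      obtain ⟨h4, rfl⟩ := ih (Prod.ext h2 h3)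
      have := θ.symm.injective (Prod.ext h1 h4)
      simp_all

/-- Left multiplication of a normal form `e_u f_v`, encoded as `(u, v)`, by a generator. -/
def normalFormStep (θ : Equiv.Perm (Fin m × Fin n)) :
    Fin m ⊕ Fin n → Function.End (List (Fin m) × List (Fin n))
  | .inl i => fun p => (i :: p.1, p.2)
  | .inr j => fun p => ((push θ j p.1).1, (push θ j p.1).2 :: p.2)

/-- The action of `𝔽_θ⁺` on the normal forms `e_u f_v` by left multiplication. -/
def normalFormAction (θ : Equiv.Perm (Fin m × Fin n)) :
    Semi θ →* Function.End (List (Fin m) × List (Fin n)) :=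
  PresentedMonoid.lift (normalFormStep θ) (by
    rintro _ _ ⟨i, j⟩
    funext p
    change normalFormStep θ (.inl i) (normalFormStep θ (.inr j) p) =
      normalFormStep θ (.inr (θ (i, j)).2) (normalFormStep θ (.inl (θ (i, j)).1) p)
    simp [normalFormStep, push])

/-- The normal form `e_u f_v` of an element of `𝔽_θ⁺`, as the pair `(u, v)`. -/
def normalForm (w : Semi θ) : List (Fin m) × List (Fin n) := normalFormAction θ w ([], [])

theorem normalForm_one : normalForm (1 : Semi θ) = ([], []) := by simp [normalForm]; rfl

theorem normalForm_e_mul (i : Fin m) (w : Semi θ) :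
    normalForm (e θ i * w) = (i :: (normalForm w).1, (normalForm w).2) := by
  simp only [normalForm, map_mul]; rfl

theorem normalForm_f_mul (j : Fin n) (w : Semi θ) :
    normalForm (f θ j * w) =
      ((push θ j (normalForm w).1).1, (push θ j (normalForm w).1).2 :: (normalForm w).2) := by
  simp only [normalForm, map_mul]; rfl

theorem eList_mul_fList_normalForm (w : Semi θ) :
    eList θ (normalForm w).1 * fList θ (normalForm w).2 = w := by
  induction w using Semi.induction with
  | one => simp [normalForm_one]
  | e_mul i w ih => simp [normalForm_e_mul, mul_assoc, ih]
  | f_mul j w ih =>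
    rw [normalForm_f_mul, fList_cons, ← mul_assoc, ← f_mul_eList, mul_assoc, ih]

theorem normalForm_injective : Function.Injective (normalForm : Semi θ → _) := fun w w' h => by
  rw [← eList_mul_fList_normalForm w, h, eList_mul_fList_normalForm]

theorem exists_mul_e (w : Semi θ) (i : Fin m) : ∃ i' w', w * e θ i = e θ i' * w' := by
  induction w using Semi.induction with
  | one => exact ⟨i, 1, by simp⟩
  | e_mul a w ih => exact ⟨a, w * e θ i, by rw [mul_assoc]⟩
  | f_mul b w ih =>
    obtain ⟨i', w', h⟩ := ih
    exact ⟨_, _, by rw [mul_assoc, h, ← mul_assoc, f_mul_e, mul_assoc]⟩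

theorem exists_mul_f (w : Semi θ) (j : Fin n) : ∃ j' w', w * f θ j = f θ j' * w' := by
  induction w using Semi.induction with
  | one => exact ⟨j, 1, by simp⟩
  | f_mul a w ih => exact ⟨a, w * f θ j, by rw [mul_assoc]⟩
  | e_mul b w ih =>
    obtain ⟨i', w', h⟩ := ih
    exact ⟨_, _, by rw [mul_assoc, h, ← mul_assoc, e_mul_f, mul_assoc]⟩

/-- Every element `w e_u` with `u` nonempty can be written with a blue letter in front; this makes
incoming blue edges exist in the vertex space of a pair of tails. -/
theorem exists_mul_eWord {k : ℕ} (hk : 0 < k) (w : Semi θ) (u : Fin k → Fin m) :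
    ∃ i w', w * eWord θ u = e θ i * w' := by
  obtain ⟨k, rfl⟩ := Nat.exists_eq_add_one.2 hk
  obtain ⟨i, w', h⟩ := exists_mul_e w (u 0)
  exact ⟨i, w' * eList θ (List.ofFn fun a => u a.succ), by
    rw [eWord_eq_eList, List.ofFn_succ, eList_cons, ← mul_assoc, h, mul_assoc]⟩

theorem exists_mul_fWord {l : ℕ} (hl : 0 < l) (w : Semi θ) (v : Fin l → Fin n) :
    ∃ j w', w * fWord θ v = f θ j * w' := by
  obtain ⟨l, rfl⟩ := Nat.exists_eq_add_one.2 hl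
  obtain ⟨j, w', h⟩ := exists_mul_f w (v 0)
  exact ⟨j, w' * fList θ (List.ofFn fun a => v a.succ), by
    rw [fWord_eq_fList, List.ofFn_succ, fList_cons, ← mul_assoc, h, mul_assoc]⟩

end Semigroup

/-! ### Actions of the semigroup with unique predecessors -/

/-- An action of `𝔽_θ⁺` such that every point has at most one incoming edge of each colour, where
`x → e_i x` is a blue edge and `x → f_j x` is a red edge. -/
class LeftUnique {m n : ℕ} (θ : Equiv.Perm (Fin m × Fin n)) (X : Type*) [MulAction (Semi θ) X] :
    Prop where
  blue_inj : ∀ {i i' : Fin m} {x x' : X}, e θ i • x = e θ i' • x' → i = i' ∧ x = x'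
  red_inj : ∀ {j j' : Fin n} {x x' : X}, f θ j • x = f θ j' • x' → j = j' ∧ x = x'

/-- An action of `𝔽_θ⁺` such that every point has exactly one incoming edge of each colour. -/
class UniquePull {m n : ℕ} (θ : Equiv.Perm (Fin m × Fin n)) (X : Type*) [MulAction (Semi θ) X] :
    Prop extends LeftUnique θ X where
  exists_blue : ∀ y : X, ∃ (i : Fin m) (x : X), e θ i • x = y
  exists_red : ∀ y : X, ∃ (j : Fin n) (x : X), f θ j • x = y

section Pull

variable {m n : ℕ} {θ : Equiv.Perm (Fin m × Fin n)}

/-- Unique factorisation in `𝔽_θ⁺`. -/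
instance : LeftUnique θ (Semi θ) where
  blue_inj {i i' x x'} h := by
    have h := congrArg normalForm h
    simp only [smul_eq_mul, normalForm_e_mul, Prod.mk.injEq, List.cons.injEq] at h
    exact ⟨h.1.1, normalForm_injective (Prod.ext h.1.2 h.2)⟩
  red_inj {j j' x x'} h := by
    have h := congrArg normalForm h
    simp only [smul_eq_mul, normalForm_f_mul, Prod.mk.injEq, List.cons.injEq] at h
    obtain ⟨h1, h2⟩ := push_injective (Prod.ext h.1 h.2.1)
    exact ⟨h1, normalForm_injective (Prod.ext h2 h.2.2)⟩

section LeftUnique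

variable {X : Type*} [MulAction (Semi θ) X] [LeftUnique θ X]

theorem eList_smul_inj {u u' : List (Fin m)} {x x' : X} (hlen : u.length = u'.length)
    (h : eList θ u • x = eList θ u' • x') : u = u' ∧ x = x' := by
  induction u generalizing u' with
  | nil => cases u' <;> simp_all
  | cons i u ih =>
    cases u' with
    | nil => simp at hlen
    | cons i' u' =>
      simp only [eList_cons, mul_smul] at h
      obtain ⟨rfl, h'⟩ := LeftUnique.blue_inj h
      obtain ⟨rfl, h''⟩ := ih (by simpa using hlen) h'
      exact ⟨rfl, h''⟩

theorem fList_smul_inj {v v' : List (Fin n)} {x x' : X} (hlen : v.length = v'.length)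
    (h : fList θ v • x = fList θ v' • x') : v = v' ∧ x = x' := by
  induction v generalizing v' with
  | nil => cases v' <;> simp_all
  | cons i u ih =>
    cases v' with
    | nil => simp at hlen
    | cons i' u' =>
      simp only [fList_cons, mul_smul] at h
      obtain ⟨rfl, h'⟩ := LeftUnique.red_inj h
      obtain ⟨rfl, h''⟩ := ih (by simpa using hlen) h'
      exact ⟨rfl, h''⟩

theorem eWord_smul_inj {k : ℕ} {u u' : Fin k → Fin m} {x x' : X}
    (h : eWord θ u • x = eWord θ u' • x') : u = u' ∧ x = x' := by
  rw [eWord_eq_eList, eWord_eq_eList] at h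
  obtain ⟨h1, h2⟩ := eList_smul_inj (by simp) h
  exact ⟨List.ofFn_injective h1, h2⟩

theorem fWord_smul_inj {l : ℕ} {v v' : Fin l → Fin n} {x x' : X}
    (h : fWord θ v • x = fWord θ v' • x') : v = v' ∧ x = x' := by
  rw [fWord_eq_fList, fWord_eq_fList] at h
  obtain ⟨h1, h2⟩ := fList_smul_inj (by simp) h
  exact ⟨List.ofFn_injective h1, h2⟩

/-- A path into a given vertex is determined by its degree. -/
theorem smul_inj_of_deg {w w' : Semi θ} {x x' : X} (hb : blueLen w = blueLen w')
    (hr : redLen w = redLen w') (h : w • x = w' • x') : w = w' ∧ x = x' := by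
  rw [← eList_mul_fList_normalForm w, ← eList_mul_fList_normalForm w'] at hb hr h ⊢
  simp only [blueLen_mul, redLen_mul, blueLen_eList, redLen_eList, blueLen_fList, redLen_fList,
    zero_add, add_zero] at hb hr
  rw [mul_smul, mul_smul] at h
  obtain ⟨h1, h⟩ := eList_smul_inj hb h
  obtain ⟨h2, h⟩ := fList_smul_inj hr h
  exact ⟨by rw [h1, h2], h⟩

end LeftUnique

section UniquePull

variable {X : Type*} [MulAction (Semi θ) X] [UniquePull θ X]

variable (θ) in
/-- The label of the blue edge into `y`. -/
def blueLabel (y : X) : Fin m := (UniquePull.exists_blue (θ := θ) y).choose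

variable (θ) in
/-- The source of the blue edge into `y`. -/
def bluePred (y : X) : X := (UniquePull.exists_blue (θ := θ) y).choose_spec.choose

variable (θ) in
/-- The label of the red edge into `y`. -/
def redLabel (y : X) : Fin n := (UniquePull.exists_red (θ := θ) y).choose

variable (θ) in
/-- The source of the red edge into `y`. -/
def redPred (y : X) : X := (UniquePull.exists_red (θ := θ) y).choose_spec.choose

theorem e_smul_bluePred (y : X) : e θ (blueLabel θ y) • bluePred θ y = y :=
  (UniquePull.exists_blue (θ := θ) y).choose_spec.choose_spec

theorem f_smul_redPred (y : X) : f θ (redLabel θ y) • redPred θ y = y :=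
  (UniquePull.exists_red (θ := θ) y).choose_spec.choose_spec

@[simp] theorem bluePred_e_smul (i : Fin m) (x : X) : bluePred θ (e θ i • x) = x :=
  (LeftUnique.blue_inj (e_smul_bluePred (e θ i • x))).2

@[simp] theorem blueLabel_e_smul (i : Fin m) (x : X) : blueLabel θ (e θ i • x) = i :=
  (LeftUnique.blue_inj (e_smul_bluePred (e θ i • x))).1

@[simp] theorem redPred_f_smul (j : Fin n) (x : X) : redPred θ (f θ j • x) = x :=
  (LeftUnique.red_inj (f_smul_redPred (f θ j • x))).2

@[simp] theorem redLabel_f_smul (j : Fin n) (x : X) : redLabel θ (f θ j • x) = j :=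
  (LeftUnique.red_inj (f_smul_redPred (f θ j • x))).1

theorem bluePred_redPred_comm :
    Function.Commute (bluePred θ : X → X) (redPred θ : X → X) := fun y => by
  have h : y = f θ (θ (blueLabel θ y, redLabel θ (bluePred θ y))).2 •
      e θ (θ (blueLabel θ y, redLabel θ (bluePred θ y))).1 • redPred θ (bluePred θ y) := by
    rw [← mul_smul, ← e_mul_f, mul_smul, f_smul_redPred, e_smul_bluePred]
  conv_lhs => rw [h, redPred_f_smul, bluePred_e_smul]

/-- The labels along the two paths of degree `(1, 1)` into `y` satisfy the relation of `𝔽_θ⁺`. -/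
theorem label_comm (y : X) :
    e θ (blueLabel θ y) * f θ (redLabel θ (bluePred θ y)) =
      f θ (redLabel θ y) * e θ (blueLabel θ (redPred θ y)) := by
  refine (smul_inj_of_deg (x := redPred θ (bluePred θ y)) (x' := bluePred θ (redPred θ y))
    (by simp) (by simp) ?_).1
  simp only [mul_smul, f_smul_redPred, e_smul_bluePred]

/-- Pulling back along a path. -/
theorem pred_iterate_smul (w : Semi θ) (x : X) :
    (redPred θ)^[redLen w] ((bluePred θ)^[blueLen w] (w • x)) = x := by
  induction w using Semi.induction with
  | one => simp
  | e_mul i w ih => simpa [mul_smul, add_comm 1] using ih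
  | f_mul j w ih =>
    rw [((bluePred_redPred_comm (θ := θ) (X := X)).symm.iterate_iterate _ _).eq] at ih ⊢
    simpa [mul_smul, add_comm 1] using ih

theorem exists_eWord_smul (k : ℕ) (y : X) :
    ∃ u : Fin k → Fin m, eWord θ u • (bluePred θ)^[k] y = y := by
  induction k generalizing y with
  | zero => exact ⟨Fin.elim0, by simp [eWord]⟩
  | succ k ih =>
    obtain ⟨u, hu⟩ := ih (bluePred θ y)
    refine ⟨Fin.cons (blueLabel θ y) u, ?_⟩
    rw [eWord_eq_eList] at hu ⊢
    rw [List.ofFn_succ]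
    simp only [Fin.cons_zero, Fin.cons_succ, eList_cons, Function.iterate_succ_apply, mul_smul]
    rw [hu, e_smul_bluePred]

theorem exists_fWord_smul (l : ℕ) (y : X) :
    ∃ v : Fin l → Fin n, fWord θ v • (redPred θ)^[l] y = y := by
  induction l generalizing y with
  | zero => exact ⟨Fin.elim0, by simp [fWord]⟩
  | succ k ih =>
    obtain ⟨u, hu⟩ := ih (redPred θ y)
    refine ⟨Fin.cons (redLabel θ y) u, ?_⟩
    rw [fWord_eq_fList] at hu ⊢
    rw [List.ofFn_succ]
    simp only [Fin.cons_zero, Fin.cons_succ, fList_cons, Function.iterate_succ_apply, mul_smul]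
    rw [hu, f_smul_redPred]

theorem bluePred_iterate_eWord_smul {k : ℕ} (u : Fin k → Fin m) (x : X) :
    (bluePred θ)^[k] (eWord θ u • x) = x := by
  simpa using pred_iterate_smul (eWord θ u) x

theorem redPred_iterate_fWord_smul {l : ℕ} (v : Fin l → Fin n) (x : X) :
    (redPred θ)^[l] (fWord θ v • x) = x := by
  simpa using pred_iterate_smul (fWord θ v) x

end UniquePull

end Pull

/-! ### The action on the vertices of an atomic representation -/

section VertexAction

variable {m n : ℕ} {θ : Equiv.Perm (Fin m × Fin n)}
variable {H : Type*} [NormedAddCommGroup H] [InnerProductSpace ℂ H]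
variable {ι : Type*}

theorem smul_basis_inj (b : HilbertBasis ι ℂ H) {c c' : ℂ} {x y : ι} (hc : c ≠ 0)
    (h : c • b x = c' • b y) : x = y ∧ c = c' := by
  classical
  have h1 := congrArg (fun v => inner ℂ (b x) v) h
  simp only [inner_smul_right, orthonormal_iff_ite.1 b.orthonormal] at h1
  by_cases hxy : x = y
  · simp_all
  · simp_all

theorem adjoint_mul_self_of_isometric [CompleteSpace H] {S : H →L[ℂ] H} (h : ∀ x, ‖S x‖ = ‖x‖) :
    ContinuousLinearMap.adjoint S * S = 1 :=
  S.norm_map_iff_adjoint_comp_self.1 h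

section Cuntz

variable {d : ℕ} {S : Fin d → H →L[ℂ] H} [CompleteSpace H]

/-- Isometries `S_i` with `∑ S_i S_i^* = I` have orthogonal ranges. -/
theorem inner_eq_zero_of_sum_eq_one (hS : ∀ i x, ‖S i x‖ = ‖x‖)
    (hsum : ∑ i, S i * ContinuousLinearMap.adjoint (S i) = 1) {i i' : Fin d} (hne : i ≠ i')
    (x x' : H) : inner ℂ (S i x) (S i' x') = 0 := by
  -- `‖v‖² = ∑ ‖S_a^* v‖²` for `v = S_{i'} x'`, and the term `a = i'` alone is `‖v‖²`.
  set v := S i' x' with hv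
  have hself : ContinuousLinearMap.adjoint (S i') v = x' :=
    congrArg (fun A : H →L[ℂ] H => A x') (adjoint_mul_self_of_isometric (hS i'))
  have hsq : ∑ a, ‖ContinuousLinearMap.adjoint (S a) v‖ ^ 2 = ‖v‖ ^ 2 := by
    have h1 := congrArg (fun A : H →L[ℂ] H => inner ℂ v (A v)) hsum
    simp only [_root_.sum_apply, mul_apply_eq_comp, inner_sum,
      one_apply_eq_self, ← ContinuousLinearMap.adjoint_inner_left,
      inner_self_eq_norm_sq_to_K] at h1
    exact_mod_cast h1
  have hle : ‖ContinuousLinearMap.adjoint (S i) v‖ ^ 2 + ‖ContinuousLinearMap.adjoint (S i') v‖ ^ 2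
      ≤ ‖v‖ ^ 2 := by
    rw [← hsq, ← Finset.sum_pair (f := fun a => ‖ContinuousLinearMap.adjoint (S a) v‖ ^ 2) hne]
    exact Finset.sum_le_sum_of_subset_of_nonneg (Finset.subset_univ _) fun _ _ _ => by positivity
  rw [hself, hv, hS] at hle
  have h0 : ContinuousLinearMap.adjoint (S i) v = 0 := by
    rw [← norm_eq_zero]
    nlinarith [norm_nonneg (ContinuousLinearMap.adjoint (S i) v)]
  rw [← ContinuousLinearMap.adjoint_inner_right, h0, inner_zero_right]

theorem exists_inner_ne_zero_of_sum_eq_one (b : HilbertBasis ι ℂ H)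
    (hsum : ∑ i, S i * ContinuousLinearMap.adjoint (S i) = 1) {v : H} (hv : v ≠ 0) :
    ∃ i x, inner ℂ (S i (b x)) v ≠ 0 := by
  by_contra! h
  refine hv ?_
  have h1 : ∀ i, ContinuousLinearMap.adjoint (S i) v = 0 := fun i => by
    refine b.repr.injective (lp.ext (funext fun x => ?_))
    rw [b.repr_apply_apply, ContinuousLinearMap.adjoint_inner_right, h, map_zero]
    rfl
  have h2 := congrArg (fun A : H →L[ℂ] H => A v) hsum
  simpa [_root_.sum_apply, h1] using h2.symm

end Cuntz

/-- The action of `𝔽_θ⁺` on the index set of the basis `b` describes how `π` permutes the lines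
spanned by the basis vectors. -/
def Implements [MulAction (Semi θ) ι] (π : Semi θ →* (H →L[ℂ] H)) (b : HilbertBasis ι ℂ H) :
    Prop :=
  ∀ w x, ∃ c : ℂ, ‖c‖ = 1 ∧ π w (b x) = c • b (w • x)

/-- The lines spanned by the basis vectors are permuted by an action of `𝔽_θ⁺`.  Incoming edges are
unique because the ranges of the `π(e_i)` (and of the `π(f_j)`) are orthogonal, and they exist
because these ranges span the whole space. -/
theorem exists_vertex_action [CompleteSpace H] {π : Semi θ →* (H →L[ℂ] H)}
    {b : HilbertBasis ι ℂ H} (hs : IsStarRep π) (ha : IsAtomic π b) :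
    ∃ _ : MulAction (Semi θ) ι, UniquePull θ ι ∧ Implements π b := by
  have key : ∀ w x, ∃ y, ∃ c : ℂ, ‖c‖ = 1 ∧ π w (b x) = c • b y := fun w x => by
    obtain ⟨y, c, hc, h⟩ := ha.2 w x
    refine ⟨y, c, hc.resolve_right fun h0 => ?_, h⟩
    have h1 := hs.1 w (b x)
    rw [h, h0, zero_smul, norm_zero, b.orthonormal.1 x] at h1
    exact zero_ne_one h1
  choose act c hc hact using key
  have hc0 : ∀ w x, c w x ≠ 0 := fun w x => by rw [← norm_ne_zero_iff, hc]; exact one_ne_zero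
  have inj : ∀ {d : ℕ} {S : Fin d → Semi θ},
      ∑ i, π (S i) * ContinuousLinearMap.adjoint (π (S i)) = 1 →
      ∀ {i i' : Fin d} {x x' : ι}, act (S i) x = act (S i') x' → i = i' ∧ x = x' := by
    intro d S hS i i' x x' h
    have hi : i = i' := by
      by_contra hne
      have h0 := inner_eq_zero_of_sum_eq_one (S := fun i => π (S i)) (fun i => hs.1 (S i)) hS hne
        (b x) (b x')
      rw [hact, hact, h, inner_smul_left, inner_smul_right, inner_self_eq_norm_sq_to_K,
        b.orthonormal.1] at h0
      simp [hc0] at h0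
    subst hi
    refine ⟨rfl, (smul_basis_inj b (hc0 (S i) x') (c' := c (S i) x) ?_).1⟩
    have hinj : Function.Injective (π (S i)) :=
      (⟨(π (S i)).toLinearMap, hs.1 (S i)⟩ : H →ₗᵢ[ℂ] H).injective
    refine hinj ?_
    rw [map_smul, map_smul, hact, hact, h, smul_smul, smul_smul, mul_comm]
  have surj : ∀ {d : ℕ} {S : Fin d → Semi θ},
      ∑ i, π (S i) * ContinuousLinearMap.adjoint (π (S i)) = 1 → ∀ y, ∃ i x, act (S i) x = y := by
    intro d S hS y
    obtain ⟨i, x, h⟩ := exists_inner_ne_zero_of_sum_eq_one b hS (v := b y)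
      (by rw [← norm_ne_zero_iff, b.orthonormal.1]; exact one_ne_zero)
    refine ⟨i, x, ?_⟩
    by_contra hne
    rw [hact, inner_smul_left, b.orthonormal.2 hne, mul_zero] at h
    exact h rfl
  let A : MulAction (Semi θ) ι :=
    { smul := act
      one_smul := fun x => by
        refine (smul_basis_inj b (hc0 1 x) (c' := 1) ?_).1
        change _ • b (act 1 x) = _
        rw [← hact, map_one, one_smul, one_apply_eq_self]
      mul_smul := fun w w' x => by
        refine (smul_basis_inj b (hc0 (w * w') x) (c' := c w' x * c w (act w' x)) ?_).1
        change _ • b (act (w * w') x) = _ • b (act w (act w' x))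
        rw [← hact, map_mul, mul_apply_eq_comp, hact w' x, map_smul, hact w, smul_smul] }
  have hL : LeftUnique θ ι := ⟨inj hs.2.1, inj hs.2.2⟩
  exact ⟨A, ⟨surj hs.2.1, surj hs.2.2⟩, fun w x => ⟨c w x, hc w x, hact w x⟩⟩

section Implements

variable [MulAction (Semi θ) ι] {π : Semi θ →* (H →L[ℂ] H)} {b : HilbertBasis ι ℂ H}

theorem Implements.carries_iff (hA : Implements π b) {w : Semi θ} {x y : ι} :
    Carries π b w x y ↔ w • x = y := by
  obtain ⟨c, hc, h⟩ := hA w x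
  have hc0 : c ≠ 0 := by rw [← norm_ne_zero_iff, hc]; exact one_ne_zero
  constructor
  · rintro ⟨c', -, h'⟩
    exact (smul_basis_inj b hc0 (h.symm.trans h')).1
  · rintro rfl
    exact ⟨c, hc0, h⟩

theorem Implements.blueEdge_iff (hA : Implements π b) {x y : ι} :
    BlueEdge π b x y ↔ ∃ i, e θ i • x = y := by
  simp only [BlueEdge, hA.carries_iff]

theorem Implements.redEdge_iff (hA : Implements π b) {x y : ι} :
    RedEdge π b x y ↔ ∃ j, f θ j • x = y := by
  simp only [RedEdge, hA.carries_iff]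

end Implements

end VertexAction

/-! ### Existence, uniqueness and compatibility of the tail data -/

section TailData

variable {m n : ℕ} {θ : Equiv.Perm (Fin m × Fin n)}

/-- The vertex `z r` is reached from `z 0` by pulling back along the blocks `u_0, …, u_{-r+1}`, and
also along the blocks `v_0, …, v_{-r+1}`. -/
def IsTailPath (θ : Equiv.Perm (Fin m × Fin n)) {X : Type*} [MulAction (Semi θ) X] {k l : ℕ}
    (u : ℕ → Fin k → Fin m) (v : ℕ → Fin l → Fin n) (z : ℕ → X) : Prop :=
  ∀ r, eWord θ (u r) • z (r + 1) = z r ∧ fWord θ (v r) • z (r + 1) = z r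

/-- If blue and red blocks lead to the same vertices at the first two corners, they do so at all
corners, and the blocks satisfy the relations: both sides of each relation are paths of the same
degree into the same vertex. -/
theorem isTailPath_of_corners {X : Type*} [MulAction (Semi θ) X] [LeftUnique θ X] {k l : ℕ}
    {u : ℕ → Fin k → Fin m} {v : ℕ → Fin l → Fin n} {p q : ℕ → X} (h0 : p 0 = q 0) (h1 : p 1 = q 1)
    (hp : ∀ r, eWord θ (u r) • p (r + 1) = p r) (hq : ∀ r, fWord θ (v r) • q (r + 1) = q r) :
    IsTailPath θ u v p ∧
      ∀ r, fWord θ (v r) * eWord θ (u (r + 1)) = eWord θ (u r) * fWord θ (v (r + 1)) := by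
  have step : ∀ r, p r = q r → p (r + 1) = q (r + 1) →
      fWord θ (v r) * eWord θ (u (r + 1)) = eWord θ (u r) * fWord θ (v (r + 1)) ∧
        p (r + 2) = q (r + 2) := fun r h h' => by
    refine smul_inj_of_deg (by simp) (by simp) ?_
    rw [mul_smul, mul_smul, hp, hq, h', hq, ← h', hp, h]
  have hpq : ∀ r, p r = q r ∧ p (r + 1) = q (r + 1) := fun r => by
    induction r with
    | zero => exact ⟨h0, h1⟩
    | succ r ih => exact ⟨ih.2, (step r ih.1 ih.2).2⟩
  refine ⟨fun r => ⟨hp r, ?_⟩, fun r => (step r (hpq r).1 (hpq r).2).1⟩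
  rw [(hpq r).1, (hpq r).2, hq]

variable {H : Type*} [NormedAddCommGroup H] [InnerProductSpace ℂ H] {ι : Type*}
variable [MulAction (Semi θ) ι] [UniquePull θ ι]
variable {π : Semi θ →* (H →L[ℂ] H)} {b : HilbertBasis ι ℂ H} {k l : ℕ} {x : ι}

theorem Implements.isTailPath (hA : Implements π b) {T : TailData m n k l}
    (hT : HasTailData π b x T) :
    ∃ z : ℕ → ι, z 0 = x ∧ IsTailPath θ T.u T.v z ∧
      π (fWord θ (T.v 0)) (b (z 1)) = (T.β : ℂ) • π (eWord θ (T.u 0)) (b (z 1)) := by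
  obtain ⟨⟨-, -, u, v, z, hu, hv⟩, p, q, hp0, hq0, hp, hq, hβ⟩ := hT
  simp only [hA.carries_iff] at hu hv hp hq
  refine ⟨p, hp0, (isTailPath_of_corners (hp0.trans hq0.symm) ?_ hp hq).1, hβ⟩
  rw [(eWord_smul_inj ((hp 0).trans (hp0.trans hu.symm))).2,
    (fWord_smul_inj ((hq 0).trans (hq0.trans hv.symm))).2]

theorem Implements.tailData_unique (hA : Implements π b) {T T' : TailData m n k l}
    (hT : HasTailData π b x T) (hT' : HasTailData π b x T') : T' = T := by
  obtain ⟨z, hz0, hz, hβ⟩ := hA.isTailPath hT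
  obtain ⟨z', hz0', hz', hβ'⟩ := hA.isTailPath hT'
  have hzz : ∀ r, z' r = z r := fun r => by
    induction r with
    | zero => rw [hz0, hz0']
    | succ r ih => exact (eWord_smul_inj ((hz' r).1.trans (ih.trans (hz r).1.symm))).2
  have hu : T'.u = T.u := funext fun r =>
    (eWord_smul_inj ((hz' r).1.trans ((hzz r).trans (hz r).1.symm))).1
  have hv : T'.v = T.v := funext fun r =>
    (fWord_smul_inj ((hz' r).2.trans ((hzz r).trans (hz r).2.symm))).1
  have hb : T'.β = T.β := by
    rw [hu, hv, hzz, hβ] at hβ'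
    obtain ⟨c, hc, h⟩ := hA (eWord θ (T.u 0)) (z 1)
    have hc0 : c ≠ 0 := by rw [← norm_ne_zero_iff, hc]; exact one_ne_zero
    rw [h, smul_smul, smul_smul] at hβ'
    have := (smul_basis_inj b (mul_ne_zero (Circle.coe_ne_zero _) hc0) hβ').2
    exact Circle.ext (mul_right_cancel₀ hc0 this).symm
  cases T; cases T'; simp_all

theorem Implements.exists_tailData (hA : Implements π b) (hx : ReturnsAbove π b k l x) :
    ∃ T : TailData m n k l, HasTailData π b x T ∧ T.Compatible θ := by
  obtain ⟨-, -, u', v', z, hu', hv'⟩ := id hx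
  simp only [hA.carries_iff] at hu' hv'
  let p : ℕ → ι := fun r => ((bluePred θ)^[k])^[r] x
  let q : ℕ → ι := fun r => ((redPred θ)^[l])^[r] x
  have hp : ∀ r, ∃ u : Fin k → Fin m, eWord θ u • p (r + 1) = p r := fun r => by
    simpa only [p, Function.iterate_succ_apply'] using exists_eWord_smul k (p r)
  have hq : ∀ r, ∃ v : Fin l → Fin n, fWord θ v • q (r + 1) = q r := fun r => by
    simpa only [q, Function.iterate_succ_apply'] using exists_fWord_smul l (q r)
  choose u hu using hp
  choose v hv using hq
  have hp1 : p 1 = z := (eWord_smul_inj ((hu 0).trans hu'.symm)).2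
  have hq1 : q 1 = z := (fWord_smul_inj ((hv 0).trans hv'.symm)).2
  obtain ⟨hz, hcomp⟩ := isTailPath_of_corners (p := p) (q := q) rfl (hp1.trans hq1.symm) hu hv
  obtain ⟨c, hc, h⟩ := hA (eWord θ (u 0)) (p 1)
  obtain ⟨c', hc', h'⟩ := hA (fWord θ (v 0)) (p 1)
  have hc0 : c ≠ 0 := by rw [← norm_ne_zero_iff, hc]; exact one_ne_zero
  refine ⟨⟨⟨c' / c, by simp [Submonoid.unitSphere, hc, hc']⟩, u, v⟩, ⟨hx, p, q, rfl, rfl,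
    fun r => hA.carries_iff.2 (hu r), fun r => hA.carries_iff.2 (hv r), ?_⟩, hcomp⟩
  rw [h, h', (hz 0).1, (hz 0).2, smul_smul]
  simp [hc0]

end TailData

/-! ### The universal vertex space of a pair of tails -/

section TailSpace

variable {m n : ℕ} {θ : Equiv.Perm (Fin m × Fin n)} {k l : ℕ}

/-- The products of blocks of `T` along which one descends from level `r` to level `N`, where the
block `u_{-s}` or the block `v_{-s}` is used between the levels `s` and `s + 1`. -/
inductive BlockPath (θ : Equiv.Perm (Fin m × Fin n)) (T : TailData m n k l) (r : ℕ) :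
    ℕ → Semi θ → Prop
  | nil : BlockPath θ T r r 1
  | blue {N : ℕ} {p : Semi θ} : BlockPath θ T r N p → BlockPath θ T r (N + 1) (p * eWord θ (T.u N))
  | red {N : ℕ} {p : Semi θ} : BlockPath θ T r N p → BlockPath θ T r (N + 1) (p * fWord θ (T.v N))

namespace BlockPath

variable {T : TailData m n k l} {r N : ℕ} {p : Semi θ}

theorem trans {M : ℕ} {q : Semi θ} (hp : BlockPath θ T r N p) (hq : BlockPath θ T N M q) :
    BlockPath θ T r M (p * q) := by
  induction hq with
  | nil => simpa using hp
  | blue _ ih => rw [← mul_assoc]; exact ih.blue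
  | red _ ih => rw [← mul_assoc]; exact ih.red

theorem exists_blue (r c : ℕ) :
    ∃ p, BlockPath θ T r (r + c) p ∧ blueLen p = c * k ∧ redLen p = 0 := by
  induction c with
  | zero => exact ⟨1, nil, by simp, by simp⟩
  | succ c ih =>
    obtain ⟨p, hp, h1, h2⟩ := ih
    exact ⟨_, hp.blue, by simp [h1]; ring, by simp [h2]⟩

theorem exists_red (r c : ℕ) :
    ∃ p, BlockPath θ T r (r + c) p ∧ blueLen p = 0 ∧ redLen p = c * l := by
  induction c with
  | zero => exact ⟨1, nil, by simp, by simp⟩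
  | succ c ih =>
    obtain ⟨p, hp, h1, h2⟩ := ih
    exact ⟨_, hp.red, by simp [h1], by simp [h2]; ring⟩

theorem smul_eq {X : Type*} [MulAction (Semi θ) X] {z : ℕ → X} (hz : IsTailPath θ T.u T.v z)
    (hp : BlockPath θ T r N p) : p • z N = z r := by
  induction hp with
  | nil => simp
  | blue _ ih => rw [mul_smul, (hz _).1, ih]
  | red _ ih => rw [mul_smul, (hz _).2, ih]

/-- By the compatibility relations, a blue block moves down through a product of blocks, whose
indices then increase by one. -/
theorem blue_shift (hT : T.Compatible θ) (hp : BlockPath θ T r N p) :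
    ∃ q, BlockPath θ T (r + 1) (N + 1) q ∧ eWord θ (T.u r) * q = p * eWord θ (T.u N) := by
  induction hp with
  | nil => exact ⟨1, nil, by simp⟩
  | blue _ ih =>
    obtain ⟨q, hq, h⟩ := ih
    exact ⟨_, hq.blue, by rw [← mul_assoc, h]⟩
  | red _ ih =>
    obtain ⟨q, hq, h⟩ := ih
    exact ⟨_, hq.red, by rw [← mul_assoc, h, mul_assoc, ← hT, mul_assoc]⟩

theorem red_shift (hT : T.Compatible θ) (hp : BlockPath θ T r N p) :
    ∃ q, BlockPath θ T (r + 1) (N + 1) q ∧ fWord θ (T.v r) * q = p * fWord θ (T.v N) := by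
  induction hp with
  | nil => exact ⟨1, nil, by simp⟩
  | red _ ih =>
    obtain ⟨q, hq, h⟩ := ih
    exact ⟨_, hq.red, by rw [← mul_assoc, h]⟩
  | blue _ ih =>
    obtain ⟨q, hq, h⟩ := ih
    exact ⟨_, hq.blue, by rw [← mul_assoc, h, mul_assoc, hT, mul_assoc]⟩

/-- Any two descents from the same level can be prolonged to a common one. -/
theorem confluent (hT : T.Compatible θ) {N' : ℕ} {p' : Semi θ} (hp : BlockPath θ T r N p)
    (hp' : BlockPath θ T r N' p') :
    ∃ M q q', BlockPath θ T N M q ∧ BlockPath θ T N' M q' ∧ p * q = p' * q' := by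
  induction hp with
  | nil => exact ⟨N', p', 1, hp', nil, by simp⟩
  | blue _ ih =>
    obtain ⟨M, q, q', hq, hq', h⟩ := ih
    obtain ⟨q₁, hq₁, h₁⟩ := hq.blue_shift hT
    exact ⟨M + 1, q₁, _, hq₁, hq'.blue, by rw [mul_assoc, h₁, ← mul_assoc, h, mul_assoc]⟩
  | red _ ih =>
    obtain ⟨M, q, q', hq, hq', h⟩ := ih
    obtain ⟨q₁, hq₁, h₁⟩ := hq.red_shift hT
    exact ⟨M + 1, q₁, _, hq₁, hq'.red, by rw [mul_assoc, h₁, ← mul_assoc, h, mul_assoc]⟩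

end BlockPath

/-- The pairs `(w, r)` and `(w', r')` are equivalent if `w` and `w'` become equal when both are
prolonged by blocks of the tails down to a common level. -/
def tailSetoid (T : TailData m n k l) (hT : T.Compatible θ) : Setoid (Semi θ × ℕ) where
  r x y := ∃ N p q, BlockPath θ T x.2 N p ∧ BlockPath θ T y.2 N q ∧ x.1 * p = y.1 * q
  iseqv :=
    { refl := fun x => ⟨x.2, 1, 1, .nil, .nil, rfl⟩
      symm := fun ⟨N, p, q, hp, hq, h⟩ => ⟨N, q, p, hq, hp, h.symm⟩
      trans := by
        rintro x y z ⟨N, p, q, hp, hq, h⟩ ⟨N', p', q', hp', hq', h'⟩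
        obtain ⟨M, a, b, ha, hb, hab⟩ := hq.confluent hT hp'
        exact ⟨M, p * a, q' * b, hp.trans ha, hq'.trans hb, by
          rw [← mul_assoc, h, mul_assoc, hab, ← mul_assoc, h', mul_assoc]⟩ }

/-- The vertices that are reached by words from the vertices pulled back along the tails of `T`:
the class of `(w, r)` is the vertex reached by `w` from the `r`-th corner. -/
def TailSpace (T : TailData m n k l) (hT : T.Compatible θ) : Type := Quotient (tailSetoid T hT)

namespace TailSpace

variable {T : TailData m n k l} (hT : T.Compatible θ)

/-- The vertex reached by `w` from the `r`-th corner of the tails. -/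
def mk (w : Semi θ) (r : ℕ) : TailSpace T hT := Quotient.mk (tailSetoid T hT) (w, r)

variable {hT}

theorem mk_eq_mk {w w' : Semi θ} {r r' : ℕ} : mk hT w r = mk hT w' r' ↔
    ∃ N p q, BlockPath θ T r N p ∧ BlockPath θ T r' N q ∧ w * p = w' * q := Quotient.eq

theorem mk_mul {r N : ℕ} {p : Semi θ} (hp : BlockPath θ T r N p) (w : Semi θ) :
    mk hT (w * p) N = mk hT w r :=
  mk_eq_mk.2 ⟨N, 1, p, .nil, hp, by simp⟩

theorem exists_rep (x : TailSpace T hT) : ∃ w r, mk hT w r = x :=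
  Quotient.inductionOn x fun p => ⟨p.1, p.2, rfl⟩

/-- Maps on `TailSpace` from maps that respect prolongation by one block. -/
def lift {Y : Type*} (F : Semi θ → ℕ → Y)
    (hb : ∀ w r, F (w * eWord θ (T.u r)) (r + 1) = F w r)
    (hr : ∀ w r, F (w * fWord θ (T.v r)) (r + 1) = F w r) : TailSpace T hT → Y :=
  Quotient.lift (fun x => F x.1 x.2) (by
    have key : ∀ {w r N p}, BlockPath θ T r N p → F (w * p) N = F w r := fun hp => by
      induction hp with
      | nil => simp
      | blue _ ih => rw [← mul_assoc, hb, ih]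
      | red _ ih => rw [← mul_assoc, hr, ih]
    rintro ⟨w, r⟩ ⟨w', r'⟩ ⟨N, p, q, hp, hq, h⟩
    change F w r = F w' r'
    rw [← key hp, ← key hq, h])

@[simp] theorem lift_mk {Y : Type*} (F : Semi θ → ℕ → Y) (hb) (hr) (w : Semi θ) (r : ℕ) :
    lift (hT := hT) F hb hr (mk hT w r) = F w r := rfl

theorem mk_mul_eWord (w : Semi θ) (r : ℕ) :
    mk hT (w * eWord θ (T.u r)) (r + 1) = mk hT w r := by
  have h : BlockPath θ T r (r + 1) (1 * eWord θ (T.u r)) := .blue .nil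
  rw [one_mul] at h
  exact mk_mul h w

theorem mk_mul_fWord (w : Semi θ) (r : ℕ) :
    mk hT (w * fWord θ (T.v r)) (r + 1) = mk hT w r := by
  have h : BlockPath θ T r (r + 1) (1 * fWord θ (T.v r)) := .red .nil
  rw [one_mul] at h
  exact mk_mul h w

instance : MulAction (Semi θ) (TailSpace T hT) where
  smul w := lift (fun w' r => mk hT (w * w') r)
    (fun w' r => by rw [← mul_assoc]; exact mk_mul_eWord _ _)
    (fun w' r => by rw [← mul_assoc]; exact mk_mul_fWord _ _)
  one_smul x := by
    obtain ⟨w, r, rfl⟩ := exists_rep x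
    change mk hT (1 * w) r = _
    rw [one_mul]
  mul_smul w w' x := by
    obtain ⟨w₀, r, rfl⟩ := exists_rep x
    change mk hT (w * w' * w₀) r = mk hT (w * (w' * w₀)) r
    rw [mul_assoc]

@[simp] theorem smul_mk (w w' : Semi θ) (r : ℕ) : w • mk hT w' r = mk hT (w * w') r := rfl

theorem mk_eq_smul (w : Semi θ) (r : ℕ) : mk hT w r = w • mk hT 1 r := by simp

theorem isTailPath : IsTailPath θ T.u T.v (fun r => mk hT 1 r) := fun r => by
  simp only [smul_mk, mul_one]
  exact ⟨by simpa using mk_mul_eWord (hT := hT) 1 r, by simpa using mk_mul_fWord (hT := hT) 1 r⟩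

instance leftUnique : LeftUnique θ (TailSpace T hT) where
  blue_inj {i i' x x'} h := by
    obtain ⟨w, r, rfl⟩ := exists_rep x
    obtain ⟨w', r', rfl⟩ := exists_rep x'
    simp only [smul_mk, mk_eq_mk, mul_assoc] at h ⊢
    obtain ⟨N, p, q, hp, hq, h⟩ := h
    obtain ⟨h1, h2⟩ := LeftUnique.blue_inj
      (show e θ i • (w * p) = e θ i' • (w' * q) from h)
    exact ⟨h1, N, p, q, hp, hq, h2⟩
  red_inj {i i' x x'} h := by
    obtain ⟨w, r, rfl⟩ := exists_rep x
    obtain ⟨w', r', rfl⟩ := exists_rep x'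
    simp only [smul_mk, mk_eq_mk, mul_assoc] at h ⊢
    obtain ⟨N, p, q, hp, hq, h⟩ := h
    obtain ⟨h1, h2⟩ := LeftUnique.red_inj
      (show f θ i • (w * p) = f θ i' • (w' * q) from h)
    exact ⟨h1, N, p, q, hp, hq, h2⟩

theorem uniquePull (hk : 0 < k) (hl : 0 < l) : UniquePull θ (TailSpace T hT) where
  exists_blue y := by
    obtain ⟨w, r, rfl⟩ := exists_rep y
    obtain ⟨i, w', h⟩ := exists_mul_eWord hk w (T.u r)
    exact ⟨i, mk hT w' (r + 1), by rw [smul_mk, ← h, mk_mul_eWord]⟩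
  exists_red y := by
    obtain ⟨w, r, rfl⟩ := exists_rep y
    obtain ⟨j, w', h⟩ := exists_mul_fWord hl w (T.v r)
    exact ⟨j, mk hT w' (r + 1), by rw [smul_mk, ← h, mk_mul_fWord]⟩

end TailSpace

end TailSpace

/-! ### Rings and periods -/

section Period

variable {m n : ℕ} {θ : Equiv.Perm (Fin m × Fin n)} {X : Type*} [MulAction (Semi θ) X]

/-- The vertices `x` and `y` lie in the same blue component. -/
def BlueConn (θ : Equiv.Perm (Fin m × Fin n)) {X : Type*} [MulAction (Semi θ) X] (x y : X) : Prop :=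
  Relation.EqvGen (fun x y : X => ∃ i, e θ i • x = y) x y

theorem Implements.sameBlue_iff {H : Type*} [NormedAddCommGroup H] [InnerProductSpace ℂ H]
    {π : Semi θ →* (H →L[ℂ] H)} {b : HilbertBasis X ℂ H} (hA : Implements π b) {x y : X} :
    SameBlue π b x y ↔ BlueConn θ x y := by
  have : BlueEdge π b = fun x y : X => ∃ i, e θ i • x = y := by
    funext x y
    exact propext hA.blueEdge_iff
  rw [SameBlue, this, BlueConn]

variable [UniquePull θ X]

theorem BlueConn.bluePred_iterate (k : ℕ) (y : X) : BlueConn θ ((bluePred θ)^[k] y) y := by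
  induction k with
  | zero => exact .refl _
  | succ k ih =>
    rw [Function.iterate_succ_apply']
    exact .trans _ _ _ (.rel _ _ ⟨_, e_smul_bluePred _⟩) ih

/-- Pulling back along red edges acts on the blue components. -/
theorem BlueConn.redPred {x y : X} (h : BlueConn θ x y) :
    BlueConn θ (redPred θ x) (redPred θ y) := by
  induction h with
  | rel x y h =>
    obtain ⟨i, rfl⟩ := h
    have h := bluePred_redPred_comm (θ := θ) (e θ i • x)
    rw [bluePred_e_smul] at h
    rw [← h]
    exact .rel _ _ ⟨_, e_smul_bluePred _⟩
  | refl => exact .refl _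
  | symm _ _ _ ih => exact .symm _ _ ih
  | trans _ _ _ _ _ ih ih' => exact .trans _ _ _ ih ih'

theorem BlueConn.redPred_iterate (t : ℕ) {x y : X} (h : BlueConn θ x y) :
    BlueConn θ ((RankTwo.redPred θ)^[t] x) ((RankTwo.redPred θ)^[t] y) := by
  induction t with
  | zero => exact h
  | succ t ih => simpa only [Function.iterate_succ_apply'] using ih.redPred

/-- No blue component contains a ring. -/
def NoBlueRing (θ : Equiv.Perm (Fin m × Fin n)) (X : Type*) [MulAction (Semi θ) X]
    [UniquePull θ X] : Prop :=
  ∀ (s : ℕ) (x : X), (bluePred θ)^[s] x = x → s = 0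

theorem NoBlueRing.iterate_inj (h : NoBlueRing θ X) {s t : ℕ} {x : X}
    (hst : (bluePred θ)^[s] x = (bluePred θ)^[t] x) : s = t := by
  wlog hle : s ≤ t generalizing s t
  · exact (this hst.symm (le_of_not_ge hle)).symm
  obtain ⟨d, rfl⟩ := Nat.exists_eq_add_of_le hle
  rw [add_comm, Function.iterate_add_apply] at hst
  have := h _ _ hst.symm
  omega

variable {k l : ℕ} {u : ℕ → Fin k → Fin m} {v : ℕ → Fin l → Fin n} {z : ℕ → X}

theorem IsTailPath.bluePred_iterate (hz : IsTailPath θ u v z) (c r : ℕ) :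
    (bluePred θ)^[c * k] (z r) = z (r + c) := by
  induction c with
  | zero => simp
  | succ c ih =>
    rw [add_mul, one_mul, add_comm, Function.iterate_add_apply, ih, ← (hz (r + c)).1,
      bluePred_iterate_eWord_smul, add_assoc]

theorem IsTailPath.redPred_iterate (hz : IsTailPath θ u v z) (c r : ℕ) :
    (redPred θ)^[c * l] (z r) = z (r + c) := by
  induction c with
  | zero => simp
  | succ c ih =>
    rw [add_mul, one_mul, add_comm, Function.iterate_add_apply, ih, ← (hz (r + c)).2,
      redPred_iterate_fWord_smul, add_assoc]

/-- If `p` blue steps and `q` red steps back from `y` lead to the same corner of the tails, then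
`(p, q)` is a multiple of `(k, l)`. -/
theorem IsTailPath.exists_eq_mul (hz : IsTailPath θ u v z) (hring : NoBlueRing θ X)
    (hper : ∀ t, 0 < t → BlueConn θ ((redPred θ)^[t] (z 0)) (z 0) → l ≤ t) (hl : 0 < l) {r p q : ℕ}
    {y : X} (hp : (bluePred θ)^[p] y = z r) (hq : (redPred θ)^[q] y = z r) :
    ∃ c, p = c * k ∧ q = c * l := by
  -- Pulling back along red edges acts on the blue components, and the orbit of the component of
  -- `z 0` has exact period `l`.
  have hzx : ∀ r, BlueConn θ (z r) (z 0) := fun r => by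
    have h := hz.bluePred_iterate r 0
    rw [zero_add] at h
    rw [← h]
    exact .bluePred_iterate _ _
  have hyx : BlueConn θ (z 0) y :=
    .symm _ _ (.trans _ _ _ (.symm _ _ (hp ▸ BlueConn.bluePred_iterate p y)) (hzx r))
  have hqx : BlueConn θ ((RankTwo.redPred θ)^[q] (z 0)) (z 0) :=
    .trans _ _ _ (hyx.redPred_iterate q) (hq ▸ hzx r)
  have hmod : BlueConn θ ((RankTwo.redPred θ)^[q % l] (z 0)) (z 0) := by
    refine .trans _ _ _ (.symm _ _ ?_) hqx
    conv_lhs => rw [← Nat.mod_add_div q l, Function.iterate_add_apply, mul_comm,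
      hz.redPred_iterate]
    exact (hzx _).redPred_iterate _
  have h0 : q % l = 0 := by
    by_contra hne
    exact absurd (hper _ (Nat.pos_of_ne_zero hne) hmod) (not_le.2 (Nat.mod_lt _ hl))
  obtain ⟨c, hc⟩ := Nat.dvd_of_mod_eq_zero h0
  rw [mul_comm] at hc
  refine ⟨c, hring.iterate_inj (x := z r) ?_, hc⟩
  rw [hz.bluePred_iterate, ← hz.redPred_iterate, ← hc]
  conv_lhs => rw [← hq, ((bluePred_redPred_comm (θ := θ) (X := X)).iterate_iterate _ _).eq, hp]

/-- Two words leading from a corner of the tails to the same vertex have degrees that differ by a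
multiple of `(k, -l)`. -/
theorem IsTailPath.deg_eq (hz : IsTailPath θ u v z) (hring : NoBlueRing θ X)
    (hper : ∀ t, 0 < t → BlueConn θ ((redPred θ)^[t] (z 0)) (z 0) → l ≤ t) (hk : 0 < k)
    (hl : 0 < l) {r : ℕ} {w w' : Semi θ} (h : w • z r = w' • z r)
    (hle : blueLen w' ≤ blueLen w) :
    ∃ c, blueLen w = blueLen w' + c * k ∧ redLen w' = redLen w + c * l := by
  have h1 := pred_iterate_smul w (z r)
  have h2 := pred_iterate_smul w' (z r)
  rw [← h] at h2
  generalize w • z r = y at h1 h2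
  generalize blueLen w = s at *
  generalize blueLen w' = s' at *
  generalize redLen w = t at *
  generalize redLen w' = t' at *
  obtain ⟨p, rfl⟩ := Nat.exists_eq_add_of_le hle
  have hcomm := fun a c (x : X) =>
    ((bluePred_redPred_comm (θ := θ) (X := X)).iterate_iterate a c).eq x
  obtain htt | htt := le_total t t'
  · obtain ⟨q, rfl⟩ := Nat.exists_eq_add_of_le htt
    obtain ⟨c, hc1, hc2⟩ := hz.exists_eq_mul hring hper hl (p := p) (q := q) (r := r)
      (y := (RankTwo.redPred θ)^[t] ((bluePred θ)^[s'] y))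
      (by rw [hcomm, ← Function.iterate_add_apply, add_comm, h1])
      (by rw [← Function.iterate_add_apply, add_comm, h2])
    exact ⟨c, by omega, by omega⟩
  · obtain ⟨q, rfl⟩ := Nat.exists_eq_add_of_le htt
    -- Here `(p, q)` steps back lead from `z r` to itself, so `l` times as many steps do, and these
    -- can be replaced by blue steps only.
    have hpq : (bluePred θ)^[p] ((RankTwo.redPred θ)^[q] (z r)) = z r := by
      conv_lhs => rw [← h2, ← Function.iterate_add_apply, hcomm, ← Function.iterate_add_apply,
        add_comm q, add_comm p, h1]
    have hfix : ((bluePred θ)^[p] ∘ (RankTwo.redPred θ)^[q])^[l] (z r) = z r :=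
      Function.iterate_fixed hpq l
    rw [((bluePred_redPred_comm (θ := θ) (X := X)).iterate_iterate p q).comp_iterate,
      Function.comp_apply, ← Function.iterate_mul, ← Function.iterate_mul, hz.redPred_iterate,
      ← hz.bluePred_iterate, ← Function.iterate_add_apply] at hfix
    have h0 := hring _ _ hfix
    have hp0 : p = 0 := by
      rcases Nat.mul_eq_zero.1 (Nat.add_eq_zero_iff.1 h0).1 with h | h <;> omega
    have hq0 : q = 0 := by
      rcases Nat.mul_eq_zero.1 (Nat.add_eq_zero_iff.1 h0).2 with h | h <;> omega
    exact ⟨0, by omega, by omega⟩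

end Period

/-! ### Representations with given data live on the universal vertex space -/

namespace TailSpace

section Map

variable {m n : ℕ} {θ : Equiv.Perm (Fin m × Fin n)} {k l : ℕ} {T : TailData m n k l}
variable {hT : T.Compatible θ} {X : Type*} [MulAction (Semi θ) X] {z : ℕ → X}

/-- The equivariant map that sends the corners of the tails to the corners of another realisation
of the same tails. -/
def toVertex (hz : IsTailPath θ T.u T.v z) : TailSpace T hT → X :=
  lift (fun w r => w • z r) (fun w r => by rw [mul_smul, (hz r).1])
    (fun w r => by rw [mul_smul, (hz r).2])

@[simp] theorem toVertex_mk (hz : IsTailPath θ T.u T.v z) (w : Semi θ) (r : ℕ) :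
    toVertex (hT := hT) hz (mk hT w r) = w • z r := rfl

theorem toVertex_smul (hz : IsTailPath θ T.u T.v z) (w : Semi θ) (x : TailSpace T hT) :
    toVertex hz (w • x) = w • toVertex hz x := by
  obtain ⟨w', r, rfl⟩ := exists_rep x
  simp [mul_smul]

theorem toVertex_surjective [LeftUnique θ X] (hk : 0 < k) (hl : 0 < l)
    (hz : IsTailPath θ T.u T.v z)
    (hconn : ∀ x y : X, Relation.EqvGen
      (fun x y => (∃ i, e θ i • x = y) ∨ ∃ j, f θ j • x = y) x y) :
    Function.Surjective (toVertex (hT := hT) hz) := by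
  have := uniquePull (hT := hT) hk hl
  have key : ∀ x y : X, Relation.EqvGen
      (fun x y => (∃ i, e θ i • x = y) ∨ ∃ j, f θ j • x = y) x y →
      (x ∈ Set.range (toVertex (hT := hT) hz) ↔ y ∈ Set.range (toVertex (hT := hT) hz)) := by
    intro x y h
    induction h with
    | refl => rfl
    | symm _ _ _ ih => exact ih.symm
    | trans _ _ _ _ _ ih ih' => exact ih.trans ih'
    | rel x y h =>
      constructor
      · rintro ⟨a, rfl⟩
        obtain ⟨i, rfl⟩ | ⟨j, rfl⟩ := h
        exacts [⟨_, toVertex_smul hz _ a⟩, ⟨_, toVertex_smul hz _ a⟩]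
      · rintro ⟨a, rfl⟩
        obtain ⟨i, h⟩ | ⟨j, h⟩ := h
        · rw [← e_smul_bluePred (θ := θ) a, toVertex_smul] at h
          exact ⟨_, (LeftUnique.blue_inj h).2.symm⟩
        · rw [← f_smul_redPred (θ := θ) a, toVertex_smul] at h
          exact ⟨_, (LeftUnique.red_inj h).2.symm⟩
  exact fun y => (key _ _ (hconn (z 0) y)).1 ⟨mk hT 1 0, by simp⟩

/-- Vertices of a representation without blue rings and with exact red period are determined by the
tails: a coincidence of two of them comes from a relation between blocks. -/
theorem toVertex_injective [UniquePull θ X] (hk : 0 < k) (hl : 0 < l)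
    (hz : IsTailPath θ T.u T.v z) (hring : NoBlueRing θ X)
    (hper : ∀ t, 0 < t → BlueConn θ ((redPred θ)^[t] (z 0)) (z 0) → l ≤ t) :
    Function.Injective (toVertex (hT := hT) hz) := by
  have key : ∀ (r : ℕ) (w w' : Semi θ), w • z r = w' • z r → blueLen w' ≤ blueLen w →
      mk hT w r = mk hT w' r := by
    intro r w w' h hle
    obtain ⟨c, hc1, hc2⟩ := hz.deg_eq hring hper hk hl h hle
    obtain ⟨p, hp, hp1, hp2⟩ := BlockPath.exists_red (θ := θ) (T := T) r c
    obtain ⟨q, hq, hq1, hq2⟩ := BlockPath.exists_blue (θ := θ) (T := T) r c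
    refine mk_eq_mk.2 ⟨_, p, q, hp, hq, ?_⟩
    refine (smul_inj_of_deg (x := z (r + c)) (x' := z (r + c)) ?_ ?_ ?_).1
    · simp [hp1, hq1, hc1]
    · simp [hp2, hq2, hc2]
    · rw [mul_smul, mul_smul, hp.smul_eq hz, hq.smul_eq hz, h]
  intro x x' h
  obtain ⟨w, r, rfl⟩ := exists_rep x
  obtain ⟨w', r', rfl⟩ := exists_rep x'
  obtain ⟨p, hp, -, -⟩ := BlockPath.exists_blue (θ := θ) (T := T) r r'
  obtain ⟨q, hq, -, -⟩ := BlockPath.exists_blue (θ := θ) (T := T) r' r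
  rw [add_comm] at hq
  rw [← mk_mul hp w, ← mk_mul hq w'] at h ⊢
  simp only [toVertex_mk] at h
  obtain hle | hle := le_total (blueLen (w' * q)) (blueLen (w * p))
  exacts [key _ _ _ h hle, (key _ _ _ h.symm hle).symm]

end Map

end TailSpace

section Basis

variable {m n : ℕ} {θ : Equiv.Perm (Fin m × Fin n)} {k l : ℕ}
variable {H : Type*} [NormedAddCommGroup H] [InnerProductSpace ℂ H]

theorem ext_basis {ι H' : Type*} [NormedAddCommGroup H'] [InnerProductSpace ℂ H']
    (b : HilbertBasis ι ℂ H) {A B : H →L[ℂ] H'} (h : ∀ x, A (b x) = B (b x)) : A = B :=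
  ContinuousLinearMap.ext_on ((Submodule.dense_iff_topologicalClosure_eq_top).2 b.dense_span)
    (by rintro _ ⟨x, rfl⟩; exact h x)

theorem exists_circle_root (hl : 0 < l) (β : Circle) : ∃ β₀ : Circle, β₀ ^ l = β := by
  refine ⟨Circle.exp (Complex.arg β / l), ?_⟩
  rw [← Circle.exp_nsmul, nsmul_eq_mul, mul_div_cancel₀ _ (by positivity : (l : ℝ) ≠ 0),
    Circle.exp_arg]

/-- Two representations that permute orthonormal bases by the same action and with the same scalars
are unitarily equivalent. -/
theorem unitarilyEquivalent_of_basis {X H' : Type*} [MulAction (Semi θ) X]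
    [NormedAddCommGroup H'] [InnerProductSpace ℂ H']
    {π : Semi θ →* (H →L[ℂ] H)} {π' : Semi θ →* (H' →L[ℂ] H')} (b : HilbertBasis X ℂ H)
    (b' : HilbertBasis X ℂ H') (c : Semi θ → ℂ) (h : ∀ w x, π w (b x) = c w • b (w • x))
    (h' : ∀ w x, π' w (b' x) = c w • b' (w • x)) : UnitarilyEquivalent π π' := by
  classical
  let U : H ≃ₗᵢ[ℂ] H' := b.repr.trans b'.repr.symm
  have hU : ∀ x, U (b x) = b' x := fun x => by simp [U, b.repr_self]
  refine ⟨U, fun w x => ?_⟩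
  have : (U : H →L[ℂ] H') ∘L π w = π' w ∘L (U : H →L[ℂ] H') := ext_basis b fun x => by
    simp [h, h', hU]
  exact congrArg (fun A : H →L[ℂ] H' => A x) this

variable {ι : Type*} [MulAction (Semi θ) ι]
variable {π : Semi θ →* (H →L[ℂ] H)} {b : HilbertBasis ι ℂ H} {T : TailData m n k l}

/-- Unit vectors along the corners of the tails can be chosen such that all blue blocks act with
scalar `1`, and then all red blocks act with the same scalar. -/
theorem Implements.exists_corner_vectors (hA : Implements π b) (hT : T.Compatible θ) {z : ℕ → ι}
    (hz : IsTailPath θ T.u T.v z)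
    (hβ : π (fWord θ (T.v 0)) (b (z 1)) = (T.β : ℂ) • π (eWord θ (T.u 0)) (b (z 1))) :
    ∃ η : ℕ → H, (∀ r, ∃ γ : ℂ, ‖γ‖ = 1 ∧ η r = γ • b (z r)) ∧
      (∀ r, π (eWord θ (T.u r)) (η (r + 1)) = η r) ∧
      ∀ r, π (fWord θ (T.v r)) (η (r + 1)) = (T.β : ℂ) • η r := by
  choose c hc hact using fun r => hA (eWord θ (T.u r)) (z (r + 1))
  simp only [(hz _).1] at hact
  have hc0 : ∀ r, c r ≠ 0 := fun r => by rw [← norm_ne_zero_iff, hc]; exact one_ne_zero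
  let γ : ℕ → ℂ := fun r => Nat.rec 1 (fun r g => g / c r) r
  have hγs : ∀ r, γ (r + 1) = γ r / c r := fun r => rfl
  have hγ : ∀ r, ‖γ r‖ = 1 := fun r => by
    induction r with
    | zero => simp [γ]
    | succ r ih => rw [hγs, norm_div, ih, hc, div_one]
  have hblue : ∀ r, π (eWord θ (T.u r)) (γ (r + 1) • b (z (r + 1))) = γ r • b (z r) := fun r => by
    rw [map_smul, hact, smul_smul, hγs, div_mul_cancel₀ _ (hc0 r)]
  refine ⟨fun r => γ r • b (z r), fun r => ⟨γ r, hγ r, rfl⟩, hblue, fun r => ?_⟩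
  induction r with
  | zero => rw [map_smul, hβ, smul_comm, ← map_smul, hblue]
  | succ r ih =>
    -- Apply both sides of the relation between the blocks to the corner vector two levels down.
    obtain ⟨d, -, hd⟩ := hA (fWord θ (T.v (r + 1))) (z (r + 2))
    rw [(hz (r + 1)).2] at hd
    have hγ0 : γ (r + 1) ≠ 0 := by exact norm_ne_zero_iff.1 (hγ (r + 1) ▸ one_ne_zero)
    have hdr : π (fWord θ (T.v (r + 1))) (γ (r + 2) • b (z (r + 2))) =
        (γ (r + 2) * d / γ (r + 1)) • γ (r + 1) • b (z (r + 1)) := by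
      rw [map_smul, hd, smul_smul, smul_smul, div_mul_cancel₀ _ hγ0]
    have h := congrArg (fun w => π w (γ (r + 2) • b (z (r + 2)))) (hT r)
    simp only [map_mul, mul_apply_eq_comp, hblue (r + 1), ih, hdr,
      map_smul (π (eWord θ (T.u r))) (γ (r + 2) * d / γ (r + 1)), hblue r] at h
    have hγr : γ r ≠ 0 := by rw [← norm_ne_zero_iff, hγ]; exact one_ne_zero
    rw [smul_smul, smul_smul] at h
    have h' := (smul_basis_inj b (mul_ne_zero (Circle.coe_ne_zero _) hγr) h).2
    rw [hdr, mul_right_cancel₀ hγr h']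

/-- A representation with the data `T` has an orthonormal basis indexed by the universal vertex
space of `T`, on which the letters `e_i` act with scalar `1` and the letters `f_j` with a fixed
`l`-th root of `β`. -/
theorem Implements.exists_tail_basis [CompleteSpace H] (hA : Implements π b)
    (hT : T.Compatible θ) {z : ℕ → ι} (hz : IsTailPath θ T.u T.v z)
    (hβ : π (fWord θ (T.v 0)) (b (z 1)) = (T.β : ℂ) • π (eWord θ (T.u 0)) (b (z 1)))
    (hinj : Function.Injective (TailSpace.toVertex (hT := hT) hz))
    (hsurj : Function.Surjective (TailSpace.toVertex (hT := hT) hz))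
    {β₀ : Circle} (hβ₀ : β₀ ^ l = T.β) :
    ∃ b' : HilbertBasis (TailSpace T hT) ℂ H,
      ∀ w x, π w (b' x) = (β₀ : ℂ) ^ redLen w • b' (w • x) := by
  obtain ⟨η, hη, hblue, hred⟩ := hA.exists_corner_vectors hT hz hβ
  have hβ0 : (β₀ : ℂ) ≠ 0 := Circle.coe_ne_zero _
  let Ψ : TailSpace T hT → H := TailSpace.lift
    (fun w r => ((β₀ : ℂ) ^ redLen w)⁻¹ • π w (η r))
    (fun w r => by simp [hblue])
    (fun w r => by
      simp only [redLen_mul, redLen_fWord, map_mul, mul_apply_eq_comp, hred, map_smul, smul_smul]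
      rw [← hβ₀, Circle.coe_pow, pow_add]
      congr 1
      field_simp)
  have hΨ : ∀ x, ∃ c : ℂ, ‖c‖ = 1 ∧ Ψ x = c • b (TailSpace.toVertex hz x) := fun x => by
    obtain ⟨w, r, rfl⟩ := TailSpace.exists_rep x
    obtain ⟨γ, hγ, h⟩ := hη r
    obtain ⟨c, hc, h'⟩ := hA w (z r)
    exact ⟨((β₀ : ℂ) ^ redLen w)⁻¹ * (γ * c), by simp [hγ, hc, Circle.norm_coe], by
      simp [Ψ, h, h', smul_smul]⟩
  have hact : ∀ w x, π w (Ψ x) = (β₀ : ℂ) ^ redLen w • Ψ (w • x) := fun w x => by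
    obtain ⟨w', r, rfl⟩ := TailSpace.exists_rep x
    simp only [Ψ, TailSpace.smul_mk, TailSpace.lift_mk, map_smul, map_mul, mul_apply_eq_comp,
      smul_smul, redLen_mul, pow_add]
    congr 1
    field_simp
  choose c hc hcΨ using hΨ
  have hc0 : ∀ x, c x ≠ 0 := fun x => by rw [← norm_ne_zero_iff, hc]; exact one_ne_zero
  have hon : Orthonormal ℂ Ψ := by
    refine ⟨fun x => by rw [hcΨ, norm_smul, hc, b.orthonormal.1, one_mul], fun x y hxy => ?_⟩
    change inner ℂ (Ψ x) (Ψ y) = 0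
    rw [hcΨ, hcΨ, inner_smul_left, inner_smul_right, b.orthonormal.2 (hinj.ne hxy), mul_zero,
      mul_zero]
  have hdense : ⊤ ≤ (Submodule.span ℂ (Set.range Ψ)).topologicalClosure := by
    rw [← b.dense_span]
    refine Submodule.topologicalClosure_mono (Submodule.span_le.2 ?_)
    rintro _ ⟨y, rfl⟩
    obtain ⟨x, rfl⟩ := hsurj y
    have : b (TailSpace.toVertex hz x) = (c x)⁻¹ • Ψ x := by
      rw [hcΨ, smul_smul, inv_mul_cancel₀ (hc0 x), one_smul]
    rw [this]
    exact Submodule.smul_mem _ _ (Submodule.subset_span ⟨x, rfl⟩)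
  exact ⟨HilbertBasis.mk hon hdense, fun w x => by simpa using hact w x⟩

end Basis

section Classification

variable {m n : ℕ} {θ : Equiv.Perm (Fin m × Fin n)} {k l : ℕ}

theorem HasTailData.compatible {H ι : Type*} [NormedAddCommGroup H] [InnerProductSpace ℂ H]
    [MulAction (Semi θ) ι] [UniquePull θ ι] {π : Semi θ →* (H →L[ℂ] H)} {b : HilbertBasis ι ℂ H}
    {T : TailData m n k l} {x : ι} (hT : HasTailData π b x T) (hA : Implements π b) :
    T.Compatible θ := by
  obtain ⟨T', hT', hc⟩ := hA.exists_tailData hT.1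
  rwa [hA.tailData_unique hT' hT]

/-- Every representation of type 3bii with the data `T` acts on the universal vertex space of `T`
in the standard way. -/
theorem IsType3bii.exists_tail_basis {H ι : Type*} [NormedAddCommGroup H] [InnerProductSpace ℂ H]
    [CompleteSpace H] {π : Semi θ →* (H →L[ℂ] H)} {b : HilbertBasis ι ℂ H} (hπ : IsType3bii π b)
    {T : TailData m n k l} {x : ι} (hT : HasTailData π b x T) (hl : 0 < l)
    {β₀ : Circle} (hβ₀ : β₀ ^ l = T.β) :
    ∃ hc : T.Compatible θ, ∃ b' : HilbertBasis (TailSpace T hc) ℂ H,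
      ∀ w y, π w (b' y) = (β₀ : ℂ) ^ redLen w • b' (w • y) := by
  obtain ⟨A, hU, hA⟩ := exists_vertex_action hπ.starRep hπ.atomic
  have hk : 0 < k := hT.1.1
  have hc := hT.compatible hA
  obtain ⟨z, hz0, hz, hβ⟩ := hA.isTailPath hT
  have hring : NoBlueRing θ ι := fun s y hs => by
    by_contra hne
    obtain ⟨u, hu⟩ := exists_eWord_smul (θ := θ) s y
    rw [hs] at hu
    exact hπ.tailByTail.1 s (Nat.pos_of_ne_zero hne) u y (hA.carries_iff.2 hu)
  have hper : ∀ t, 0 < t → BlueConn θ ((redPred θ)^[t] (z 0)) (z 0) → l ≤ t := fun t ht h => by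
    obtain ⟨v, hv⟩ := exists_fWord_smul (θ := θ) t (z 0)
    rw [hz0] at hv h
    exact hT.1.2.1.2 ⟨ht, v, _, hA.carries_iff.2 hv, hA.sameBlue_iff.2 h⟩
  have hconn : ∀ x y : ι, Relation.EqvGen
      (fun x y => (∃ i, e θ i • x = y) ∨ ∃ j, f θ j • x = y) x y := fun x y => by
    simpa only [hA.blueEdge_iff, hA.redEdge_iff] using hπ.connected.2 x y
  exact ⟨hc, hA.exists_tail_basis hc hz hβ
    (TailSpace.toVertex_injective hk hl hz hring hper)
    (TailSpace.toVertex_surjective hk hl hz hconn) hβ₀⟩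

end Classification

/-! ### The representation of an action -/

section StdBasis

/-- The standard basis of `ℓ²(X)`. -/
def stdBasis (X : Type*) : HilbertBasis X ℂ (Ell2 X) := .ofRepr (.refl ℂ _)

@[simp] theorem stdBasis_apply {X : Type*} (x : X) : stdBasis X x = ξ x := rfl

theorem orthonormal_ξ {X : Type*} : Orthonormal ℂ (ξ : X → Ell2 X) := (stdBasis X).orthonormal

/-- The isometry on `ℓ²(X)` that sends the standard basis to an orthonormal family. -/
def ofFamily {X H : Type*} [NormedAddCommGroup H] [InnerProductSpace ℂ H] [CompleteSpace H]
    {v : X → H} (hv : Orthonormal ℂ v) : Ell2 X →ₗᵢ[ℂ] H :=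
  hv.orthogonalFamily.linearIsometry

theorem ofFamily_ξ {X H : Type*} [NormedAddCommGroup H] [InnerProductSpace ℂ H] [CompleteSpace H]
    {v : X → H} (hv : Orthonormal ℂ v) (x : X) : ofFamily hv (ξ x) = v x := by
  classical
  have h := hv.orthogonalFamily.linearIsometry_apply_single (1 : ℂ) (i := x)
  rw [LinearIsometry.toSpanSingleton_apply, one_smul] at h
  exact h

theorem ext_ξ {X H : Type*} [NormedAddCommGroup H] [InnerProductSpace ℂ H]
    {A B : Ell2 X →L[ℂ] H} (h : ∀ x, A (ξ x) = B (ξ x)) : A = B :=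
  ext_basis (stdBasis X) h

end StdBasis

section ActionRep

variable {m n : ℕ} {θ : Equiv.Perm (Fin m × Fin n)} {X : Type*} [MulAction (Semi θ) X]

theorem smul_injective [LeftUnique θ X] (w : Semi θ) : Function.Injective (w • · : X → X) :=
  fun _ _ h => (smul_inj_of_deg rfl rfl h).2

theorem orthonormal_smul_ξ [LeftUnique θ X] (β₀ : Circle) (w : Semi θ) :
    Orthonormal ℂ (fun x : X => (β₀ : ℂ) ^ redLen w • ξ (w • x)) := by
  refine ⟨fun x => ?_, fun x y hxy => ?_⟩
  · rw [norm_smul, norm_pow, Circle.norm_coe, one_pow, one_mul, orthonormal_ξ.1]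
  · change inner ℂ (_ • ξ (w • x)) (_ • ξ (w • y)) = 0
    rw [inner_smul_left, inner_smul_right, orthonormal_ξ.2 ((smul_injective w).ne hxy), mul_zero,
      mul_zero]

/-- The representation on `ℓ²(X)` of an action on `X`: the letters `e_i` carry `ξ_x` to
`ξ_{e_i x}`, and the letters `f_j` carry `ξ_x` to `β₀ ξ_{f_j x}`. -/
def actionRep (θ : Equiv.Perm (Fin m × Fin n)) (X : Type*) [MulAction (Semi θ) X] [LeftUnique θ X]
    (β₀ : Circle) : Semi θ →* (Ell2 X →L[ℂ] Ell2 X) where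
  toFun w := (ofFamily (orthonormal_smul_ξ (X := X) β₀ w)).toContinuousLinearMap
  map_one' := ext_ξ fun x => by simp [ofFamily_ξ]
  map_mul' w w' := ext_ξ fun x => by
    change ofFamily (orthonormal_smul_ξ β₀ (w * w')) (ξ x) = ofFamily (orthonormal_smul_ξ β₀ w)
      (ofFamily (orthonormal_smul_ξ β₀ w') (ξ x))
    rw [ofFamily_ξ, ofFamily_ξ, map_smul, ofFamily_ξ, smul_smul, mul_smul, redLen_mul, pow_add]
    congr 1
    exact mul_comm _ _

variable [LeftUnique θ X] {β₀ : Circle}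

theorem actionRep_ξ (w : Semi θ) (x : X) :
    actionRep θ X β₀ w (ξ x) = (β₀ : ℂ) ^ redLen w • ξ (w • x) :=
  ofFamily_ξ (orthonormal_smul_ξ β₀ w) x

theorem norm_circle_pow (β₀ : Circle) (r : ℕ) : ‖(β₀ : ℂ) ^ r‖ = 1 := by simp [Circle.norm_coe]

theorem actionRep_implements : Implements (actionRep θ X β₀) (stdBasis X) := fun w x =>
  ⟨_, norm_circle_pow β₀ _, actionRep_ξ w x⟩

theorem actionRep_isIsometric : IsIsometric (actionRep θ X β₀) := fun w =>
  (ofFamily (orthonormal_smul_ξ β₀ w)).norm_map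

theorem actionRep_isAtomic : IsAtomic (actionRep θ X β₀) (stdBasis X) :=
  ⟨fun w => by rw [mul_assoc, adjoint_mul_self_of_isometric (actionRep_isIsometric w), mul_one],
    fun w x => ⟨w • x, _, .inl (norm_circle_pow β₀ (redLen w)), actionRep_ξ w x⟩⟩

/-- Isometries with orthogonal ranges that together reach all basis vectors have ranges adding up to
the whole space. -/
theorem sum_eq_one_of_reach {H ι : Type*} [NormedAddCommGroup H] [InnerProductSpace ℂ H]
    [CompleteSpace H] (b : HilbertBasis ι ℂ H) {d : ℕ} {S : Fin d → H →L[ℂ] H}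
    (hS : ∀ i x, ‖S i x‖ = ‖x‖)
    (hort : ∀ i i', i ≠ i' → ∀ x x', inner ℂ (S i (b x)) (S i' (b x')) = 0)
    (hreach : ∀ y, ∃ i x, ∃ c : ℂ, b y = c • S i (b x)) :
    ∑ i, S i * ContinuousLinearMap.adjoint (S i) = 1 := by
  refine ext_basis b fun y => ?_
  obtain ⟨i, x, c, hy⟩ := hreach y
  have hself : ContinuousLinearMap.adjoint (S i) (S i (b x)) = b x :=
    congrArg (fun A : H →L[ℂ] H => A (b x)) (adjoint_mul_self_of_isometric (hS i))
  have hother : ∀ i', i' ≠ i → ContinuousLinearMap.adjoint (S i') (S i (b x)) = 0 := fun i' hi =>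
    b.repr.injective (lp.ext (funext fun x' => by
      rw [b.repr_apply_apply, ContinuousLinearMap.adjoint_inner_right, hort _ _ hi, map_zero]
      rfl))
  rw [hy, map_smul, map_smul, _root_.sum_apply, Finset.sum_eq_single i]
  · rw [mul_apply_eq_comp, hself, one_apply_eq_self]
  · intro i' _ hi
    rw [mul_apply_eq_comp, hother i' hi, map_zero]
  · simp

end ActionRep

theorem actionRep_isStarRep {m n : ℕ} {θ : Equiv.Perm (Fin m × Fin n)} {X : Type*}
    [MulAction (Semi θ) X] [UniquePull θ X] {β₀ : Circle} : IsStarRep (actionRep θ X β₀) := by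
  have hort : ∀ {w w' : Semi θ} {x x' : X}, w • x ≠ w' • x' →
      inner ℂ (actionRep θ X β₀ w (stdBasis X x)) (actionRep θ X β₀ w' (stdBasis X x')) = 0 := by
    intro w w' x x' h
    rw [stdBasis_apply, stdBasis_apply, actionRep_ξ, actionRep_ξ, inner_smul_left,
      inner_smul_right, orthonormal_ξ.2 h, mul_zero, mul_zero]
  have hreach : ∀ (w : Semi θ) (x : X), stdBasis X (w • x) =
      ((β₀ : ℂ) ^ redLen w)⁻¹ • actionRep θ X β₀ w (stdBasis X x) := fun w x => by
    rw [stdBasis_apply, stdBasis_apply, actionRep_ξ, smul_smul, inv_mul_cancel₀, one_smul]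
    exact pow_ne_zero _ (Circle.coe_ne_zero _)
  refine ⟨actionRep_isIsometric, sum_eq_one_of_reach (stdBasis X)
    (fun i => actionRep_isIsometric (e θ i))
    (fun i i' hi x x' => hort fun h => hi (LeftUnique.blue_inj h).1) fun y => ?_,
    sum_eq_one_of_reach (stdBasis X) (fun j => actionRep_isIsometric (f θ j))
    (fun i i' hi x x' => hort fun h => hi (LeftUnique.red_inj h).1) fun y => ?_⟩
  · obtain ⟨i, x, rfl⟩ := UniquePull.exists_blue (θ := θ) y
    exact ⟨i, x, _, hreach _ x⟩
  · obtain ⟨j, x, rfl⟩ := UniquePull.exists_red (θ := θ) y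
    exact ⟨j, x, _, hreach _ x⟩

/-! ### The standard representation with given data -/

section Cls

variable {k l : ℕ}

theorem cls_eq_cls {s t s' t' : ℤ} :
    cls k l s t = cls k l s' t' ↔ ∃ c : ℤ, s' = s + c * k ∧ t' = t - c * l := by
  rw [cls, cls, QuotientAddGroup.eq, AddSubgroup.mem_zmultiples_iff]
  simp only [Prod.ext_iff, Prod.smul_mk, smul_eq_mul, Prod.neg_mk, Prod.mk_add_mk]
  exact exists_congr fun c => by
    constructor <;> rintro ⟨h1, h2⟩ <;> constructor <;> linarith

theorem cls_add (s t s' t' : ℤ) : cls k l s t + cls k l s' t' = cls k l (s + s') (t + t') := rfl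

theorem cls_sub (s t s' t' : ℤ) : cls k l s t - cls k l s' t' = cls k l (s - s') (t - t') := rfl

theorem cls_zero : cls k l 0 0 = 0 := rfl

theorem exists_cls (g : SpiralGroup k l) : ∃ s t, cls k l s t = g :=
  QuotientAddGroup.induction_on g fun p => ⟨p.1, p.2, rfl⟩

theorem closure_cls : AddSubgroup.closure {cls k l 1 0, cls k l 0 1} = ⊤ := by
  refine (AddSubgroup.eq_top_iff' _).2 fun g => ?_
  obtain ⟨s, t, rfl⟩ := exists_cls g
  have h : cls k l s t = s • cls k l 1 0 + t • cls k l 0 1 := by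
    rw [cls, cls, cls, ← QuotientAddGroup.mk_zsmul, ← QuotientAddGroup.mk_zsmul,
      ← QuotientAddGroup.mk_add]
    simp
  rw [h]
  exact add_mem (zsmul_mem (AddSubgroup.subset_closure (by simp)) _)
    (zsmul_mem (AddSubgroup.subset_closure (by simp)) _)

end Cls

namespace TailSpace

variable {m n : ℕ} {θ : Equiv.Perm (Fin m × Fin n)} {k l : ℕ} {T : TailData m n k l}
variable {hT : T.Compatible θ}

/-- The position of a vertex in `ℤ² / ℤ(k, -l)`: words move it by their degree, and the `r`-th
corner lies at `[-rk, 0] = [0, -rl]`. -/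
def pos : TailSpace T hT → SpiralGroup k l :=
  lift (fun w r => cls k l (blueLen w - r * k) (redLen w))
    (fun w r => by simp; congr 1; ring)
    (fun w r => by
      simp only [blueLen_mul, redLen_mul, blueLen_fWord, redLen_fWord]
      exact cls_eq_cls.2 ⟨1, by push_cast; ring, by push_cast; ring⟩)

@[simp] theorem pos_mk (w : Semi θ) (r : ℕ) :
    pos (mk hT w r) = cls k l (blueLen w - r * k) (redLen w) := rfl

theorem pos_smul (w : Semi θ) (x : TailSpace T hT) :
    pos (w • x) = pos x + cls k l (blueLen w) (redLen w) := by
  obtain ⟨w', r, rfl⟩ := exists_rep x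
  simp only [smul_mk, pos_mk, cls_add, blueLen_mul, redLen_mul]
  congr 1 <;> push_cast <;> ring

theorem deg_eq_zero_of_smul_eq {w : Semi θ} {x : TailSpace T hT} (h : w • x = x) :
    ∃ c : ℤ, (blueLen w : ℤ) = c * k ∧ (redLen w : ℤ) = - (c * l) := by
  have h1 := pos_smul w x
  rw [h, left_eq_add, ← cls_zero, eq_comm, cls_eq_cls] at h1
  simpa using h1

theorem eqvGen_smul (w : Semi θ) (x : TailSpace T hT) : Relation.EqvGen
    (fun x y : TailSpace T hT => (∃ i, e θ i • x = y) ∨ ∃ j, f θ j • x = y) x (w • x) := by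
  induction w using Semi.induction with
  | one => rw [one_smul]; exact .refl _
  | e_mul i w ih => rw [mul_smul]; exact .trans _ _ _ ih (.rel _ _ (.inl ⟨i, rfl⟩))
  | f_mul j w ih => rw [mul_smul]; exact .trans _ _ _ ih (.rel _ _ (.inr ⟨j, rfl⟩))

theorem eqvGen_base (x : TailSpace T hT) : Relation.EqvGen
    (fun x y : TailSpace T hT => (∃ i, e θ i • x = y) ∨ ∃ j, f θ j • x = y) (mk hT 1 0) x := by
  obtain ⟨w, r, rfl⟩ := exists_rep x
  rw [mk_eq_smul w r]
  refine .trans _ _ _ ?_ (eqvGen_smul _ _)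
  induction r with
  | zero => exact .refl _
  | succ r ih =>
    refine .trans _ _ _ ih (.symm _ _ ?_)
    have h : mk hT 1 r = eWord θ (T.u r) • mk hT 1 (r + 1) := (isTailPath r).1.symm
    rw [h]
    exact eqvGen_smul _ _

theorem pos_of_blueConn {x y : TailSpace T hT} (h : BlueConn θ x y) :
    ∃ a : ℤ, pos y = pos x + cls k l a 0 := by
  induction h with
  | rel x y h =>
    obtain ⟨i, rfl⟩ := h
    exact ⟨1, by simp [pos_smul]⟩
  | refl => exact ⟨0, by rw [cls_zero, add_zero]⟩
  | symm _ _ _ ih =>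
    obtain ⟨a, h⟩ := ih
    exact ⟨-a, by rw [h, add_assoc, cls_add, add_neg_cancel, add_zero, cls_zero, add_zero]⟩
  | trans _ _ _ _ _ ih ih' =>
    obtain ⟨a, h⟩ := ih
    obtain ⟨a', h'⟩ := ih'
    exact ⟨a + a', by rw [h', h, add_assoc, cls_add, add_zero]⟩

theorem returnsAbove (hk : 0 < k) (hl : 0 < l) (β₀ : Circle) :
    ReturnsAbove (actionRep θ (TailSpace T hT) β₀) (stdBasis _) k l (mk hT 1 0) := by
  have hA : Implements (actionRep θ (TailSpace T hT) β₀) (stdBasis _) := actionRep_implements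
  have := uniquePull (hT := hT) hk hl
  have h1 : eWord θ (T.u 0) • mk hT 1 1 = mk hT 1 0 := (isTailPath 0).1
  have h2 : fWord θ (T.v 0) • mk hT 1 1 = mk hT 1 0 := (isTailPath 0).2
  refine ⟨hk, ⟨⟨hl, T.v 0, mk hT 1 1, hA.carries_iff.2 h2, hA.sameBlue_iff.2 ?_⟩, ?_⟩,
    T.u 0, T.v 0, mk hT 1 1, hA.carries_iff.2 h1, hA.carries_iff.2 h2⟩
  · have h3 := bluePred_iterate_eWord_smul (θ := θ) (T.u 0) (mk hT 1 1)
    rw [h1] at h3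
    rw [← h3]
    exact .bluePred_iterate _ _
  · rintro t ⟨ht, v, z, hv, hz⟩
    rw [hA.carries_iff] at hv
    rw [hA.sameBlue_iff] at hz
    -- The displacement `[0, t]` equals some `[a, 0]`, so `l` divides `t`.
    obtain ⟨a, ha⟩ := pos_of_blueConn hz
    have hpos := pos_smul (fWord θ v) z
    rw [hv, ha, add_right_inj, blueLen_fWord, redLen_fWord, cls_eq_cls] at hpos
    obtain ⟨c, -, hc⟩ := hpos
    have hdvd : (l : ℤ) ∣ t := ⟨-c, by rw [hc]; ring⟩
    exact Nat.le_of_dvd ht (Int.natCast_dvd_natCast.1 hdvd)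

theorem isType3bii (hk : 0 < k) (hl : 0 < l) (β₀ : Circle) :
    IsType3bii (actionRep θ (TailSpace T hT) β₀) (stdBasis _) := by
  have hA : Implements (actionRep θ (TailSpace T hT) β₀) (stdBasis _) := actionRep_implements
  have := uniquePull (hT := hT) hk hl
  refine ⟨actionRep_isStarRep, actionRep_isAtomic, ⟨⟨mk hT 1 0⟩, fun x y => ?_⟩,
    ⟨fun s hs u x h => ?_, fun t ht v x h => ?_⟩, k, l, _, returnsAbove hk hl β₀⟩
  · simp only [hA.blueEdge_iff, hA.redEdge_iff]
    exact .trans _ _ _ (.symm _ _ (eqvGen_base x)) (eqvGen_base y)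
  · obtain ⟨c, h1, h2⟩ := deg_eq_zero_of_smul_eq (hA.carries_iff.1 h)
    simp only [blueLen_eWord, redLen_eWord, Nat.cast_zero, zero_eq_neg, mul_eq_zero,
      Nat.cast_eq_zero, hl.ne', or_false] at h1 h2
    simp [h2, hs.ne'] at h1
  · obtain ⟨c, h1, h2⟩ := deg_eq_zero_of_smul_eq (hA.carries_iff.1 h)
    simp only [blueLen_fWord, redLen_fWord, Nat.cast_zero, zero_eq_mul,
      Nat.cast_eq_zero, hk.ne', or_false] at h1 h2
    simp [h1, ht.ne'] at h2

theorem hasTailData (hk : 0 < k) (hl : 0 < l) {β₀ : Circle} (hβ₀ : β₀ ^ l = T.β) :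
    HasTailData (actionRep θ (TailSpace T hT) β₀) (stdBasis _) (mk hT 1 0) T := by
  have hA : Implements (actionRep θ (TailSpace T hT) β₀) (stdBasis _) := actionRep_implements
  have hz := isTailPath (hT := hT)
  refine ⟨returnsAbove hk hl β₀, fun r => mk hT 1 r, fun r => mk hT 1 r, rfl, rfl,
    fun r => hA.carries_iff.2 (hz r).1, fun r => hA.carries_iff.2 (hz r).2, ?_⟩
  have h1 : eWord θ (T.u 0) • mk hT 1 1 = mk hT 1 0 := (isTailPath 0).1
  have h2 : fWord θ (T.v 0) • mk hT 1 1 = mk hT 1 0 := (isTailPath 0).2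
  rw [stdBasis_apply, actionRep_ξ, actionRep_ξ, h1, h2, redLen_fWord, redLen_eWord, pow_zero,
    one_smul, ← hβ₀, Circle.coe_pow]

end TailSpace

/-! ### Compressions -/

section Compression

open ContinuousLinearMap

variable {m n : ℕ} {θ : Equiv.Perm (Fin m × Fin n)}
variable {H H' : Type*} [NormedAddCommGroup H] [InnerProductSpace ℂ H] [CompleteSpace H]
  [NormedAddCommGroup H'] [InnerProductSpace ℂ H'] [CompleteSpace H']
  {π : Semi θ →* (H' →L[ℂ] H')} {V : H →ₗᵢ[ℂ] H'}

theorem adjoint_comp_isometry (V : H →ₗᵢ[ℂ] H') (x : H) :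
    adjoint V.toContinuousLinearMap (V x) = x :=
  congrArg (fun A : H →L[ℂ] H => A x)
    (V.toContinuousLinearMap.norm_map_iff_adjoint_comp_self.1 V.norm_map)

/-- The compression of `π` to a subspace whose orthogonal complement is invariant. -/
def compression (π : Semi θ →* (H' →L[ℂ] H')) (V : H →ₗᵢ[ℂ] H')
    (hV : ∀ w y, adjoint V.toContinuousLinearMap (π w (V (adjoint V.toContinuousLinearMap y))) =
      adjoint V.toContinuousLinearMap (π w y)) : Semi θ →* (H →L[ℂ] H) where
  toFun w := adjoint V.toContinuousLinearMap ∘L π w ∘L V.toContinuousLinearMap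
  map_one' := by
    ext x
    simpa using adjoint_comp_isometry V x
  map_mul' w w' := by
    ext x
    simp only [map_mul, comp_apply, mul_apply_eq_comp, LinearIsometry.coe_toContinuousLinearMap]
    exact (hV _ _).symm

variable (hV : ∀ w y,
  adjoint V.toContinuousLinearMap (π w (V (adjoint V.toContinuousLinearMap y))) =
    adjoint V.toContinuousLinearMap (π w y))

theorem compression_apply (w : Semi θ) (x : H) :
    compression π V hV w x = adjoint V.toContinuousLinearMap (π w (V x)) := rfl

theorem compression_mul_adjoint (w : Semi θ) :
    compression π V hV w * adjoint (compression π V hV w) =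
      adjoint V.toContinuousLinearMap ∘L (π w * adjoint (π w)) ∘L V.toContinuousLinearMap := by
  ext x
  have h : adjoint (compression π V hV w) =
      adjoint V.toContinuousLinearMap ∘L adjoint (π w) ∘L V.toContinuousLinearMap := by
    change adjoint (adjoint V.toContinuousLinearMap ∘L π w ∘L V.toContinuousLinearMap) = _
    rw [adjoint_comp, adjoint_comp, adjoint_adjoint]
    rfl
  rw [h, mul_apply_eq_comp, compression_apply]
  exact hV _ _

theorem compression_sum {d : ℕ} {S : Fin d → Semi θ}
    (h : ∑ i, π (S i) * adjoint (π (S i)) = 1) :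
    ∑ i, compression π V hV (S i) * adjoint (compression π V hV (S i)) = 1 := by
  ext x
  have h' := congrArg (fun A : H' →L[ℂ] H' => adjoint V.toContinuousLinearMap (A (V x))) h
  simp only [_root_.sum_apply, map_sum, one_apply_eq_self, adjoint_comp_isometry] at h'
  simp only [compression_mul_adjoint, _root_.sum_apply, one_apply_eq_self]
  exact h'

end Compression

/-! ### Embedding the group into the vertex space -/

section Labels

variable {m n : ℕ} {θ : Equiv.Perm (Fin m × Fin n)} {X : Type*} [MulAction (Semi θ) X]
  [UniquePull θ X]

theorem blueLabel_iterate_eWord_smul {k : ℕ} (u : Fin k → Fin m) (x : X) (a : Fin k) :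
    blueLabel θ ((bluePred θ)^[(a : ℕ)] (eWord θ u • x)) = u a := by
  induction k with
  | zero => exact a.elim0
  | succ k ih =>
    have h : eWord θ u = e θ (u 0) * eWord θ (fun a => u a.succ) := by
      rw [eWord_eq_eList, List.ofFn_succ, eList_cons, eWord_eq_eList]
    rw [h, mul_smul]
    refine Fin.cases ?_ (fun a => ?_) a
    · simp
    · rw [Fin.val_succ, Function.iterate_succ_apply, bluePred_e_smul, ih]

theorem redLabel_iterate_fWord_smul {l : ℕ} (v : Fin l → Fin n) (x : X) (a : Fin l) :
    redLabel θ ((redPred θ)^[(a : ℕ)] (fWord θ v • x)) = v a := by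
  induction l with
  | zero => exact a.elim0
  | succ k ih =>
    have h : fWord θ v = f θ (v 0) * fWord θ (fun a => v a.succ) := by
      rw [fWord_eq_fList, List.ofFn_succ, fList_cons, fWord_eq_fList]
    rw [h, mul_smul]
    refine Fin.cases ?_ (fun a => ?_) a
    · simp
    · rw [Fin.val_succ, Function.iterate_succ_apply, redPred_f_smul, ih]

end Labels

namespace TailSpace

variable {m n : ℕ} {θ : Equiv.Perm (Fin m × Fin n)} {k l : ℕ} {T : TailData m n k l}

/-- Repeating the blocks between two occurrences of the same pair continues the tails beyond the
`R`-th corner: `N s` is the index of the block used between the levels `s` and `s + 1`. -/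
theorem _root_.RankTwo.TailData.Recurs.exists_periodic {R : ℕ} (hR : T.Recurs R) :
    ∃ N : ℤ → ℕ, (∀ s : ℕ, R ≤ s → N s = s) ∧
      ∀ s, T.u (N (s + 1)) = T.u (N s + 1) ∧ T.v (N (s + 1)) = T.v (N s + 1) := by
  obtain ⟨r, hr, hu, hv⟩ := hR
  obtain ⟨d, rfl⟩ := Nat.exists_eq_add_of_lt hr
  let N : ℤ → ℕ := fun s => if (R : ℤ) ≤ s then s.toNat else R + ((s - R) % (d + 1 : ℤ)).toNat
  have hN : ∀ s : ℤ, (R : ℤ) ≤ s → N s = s.toNat := fun s hs => if_pos hs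
  have hN' : ∀ s : ℤ, s < R → N s = R + ((s - R) % (d + 1 : ℤ)).toNat := fun s hs =>
    if_neg (not_le.2 hs)
  refine ⟨N, fun s hs => by rw [hN _ (by exact_mod_cast hs)]; simp, fun s => ?_⟩
  have key : N (s + 1) = N s + 1 ∨ N (s + 1) = R ∧ N s + 1 = R + d + 1 := by
    obtain hs | hs := le_or_gt (R : ℤ) s
    · rw [hN _ hs, hN _ (by omega)]
      omega
    · rw [hN' _ hs]
      have h0 := Int.emod_nonneg (s - R) (by omega : (d + 1 : ℤ) ≠ 0)
      have h1 := Int.emod_lt_of_pos (s - R) (by omega : (0 : ℤ) < d + 1)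
      have h2 := Int.mul_ediv_add_emod (s - R) (d + 1 : ℤ)
      have h3 : N (s + 1) = R + ((s + 1 - R) % (d + 1 : ℤ)).toNat := by
        obtain h | h := lt_or_ge (s + 1) (R : ℤ)
        · exact hN' _ h
        · have : s + 1 = R := by omega
          rw [hN _ h, this]
          simp
      rw [h3]
      obtain h | h := lt_or_ge ((s - R) % (d + 1 : ℤ) + 1) (d + 1 : ℤ)
      · have : (s + 1 - R) % (d + 1 : ℤ) = (s - R) % (d + 1 : ℤ) + 1 := by
          rw [show s + 1 - R = (s - R) + 1 by ring, ← Int.emod_add_emod, Int.emod_eq_of_lt] <;>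
            omega
        omega
      · have : (s + 1 - R) % (d + 1 : ℤ) = 0 := by
          have hd : (s - R) % (d + 1 : ℤ) = d := by omega
          rw [show s + 1 - R = (s - R) + 1 by ring, ← Int.emod_add_emod, hd, Int.emod_self]
        omega
  obtain h | ⟨h1, h2⟩ := key
  · rw [h]; exact ⟨rfl, rfl⟩
  · rw [h1, h2]; exact ⟨hu.symm, hv.symm⟩

variable {hT : T.Compatible θ}

/-- The corners of the tails from the `R`-th one on, continued periodically in the other
direction. -/
theorem exists_corners {R : ℕ} (hR : T.Recurs R) :
    ∃ (N : ℤ → ℕ) (ζ : ℤ → TailSpace T hT), (∀ s : ℕ, R ≤ s → N s = s ∧ ζ s = mk hT 1 s) ∧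
      ∀ s, eWord θ (T.u (N s)) • ζ (s + 1) = ζ s ∧ fWord θ (T.v (N s)) • ζ (s + 1) = ζ s := by
  obtain ⟨N, hN, hper⟩ := hR.exists_periodic
  let y : ℕ → TailSpace T hT := fun t =>
    Nat.rec (mk hT 1 R) (fun t x => eWord θ (T.u (N ((R : ℤ) - t - 1))) • x) t
  have hy : ∀ t : ℕ, y (t + 1) = eWord θ (T.u (N ((R : ℤ) - t - 1))) • y t := fun t => rfl
  let ζ : ℤ → TailSpace T hT := fun s =>
    if (R : ℤ) ≤ s then mk hT 1 s.toNat else y ((R : ℤ) - s).toNat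
  have hζ : ∀ s : ℕ, R ≤ s → ζ s = mk hT 1 s := fun s hs => by
    simp only [ζ]
    rw [if_pos (by exact_mod_cast hs), Int.toNat_natCast]
  have hζ' : ∀ t : ℕ, ζ ((R : ℤ) - t) = y t := fun t => by
    simp only [ζ]
    split_ifs with h
    · have : t = 0 := by omega
      subst this
      simp [y]
    · congr 1
      omega
  have hblue : ∀ s, eWord θ (T.u (N s)) • ζ (s + 1) = ζ s := fun s => by
    obtain h | h := le_or_gt (R : ℤ) s
    · lift s to ℕ using by omega
      have hs : R ≤ s := by exact_mod_cast h
      have h1 := hζ (s + 1) (by omega)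
      push_cast at h1
      rw [hN s hs, hζ s hs, h1]
      exact (isTailPath s).1
    · obtain ⟨t, rfl⟩ : ∃ t : ℕ, s = (R : ℤ) - t - 1 := ⟨((R : ℤ) - s - 1).toNat, by omega⟩
      have h1 := hζ' (t + 1)
      push_cast at h1
      rw [← sub_sub] at h1
      rw [h1, sub_add_cancel, hζ', hy]
  refine ⟨N, ζ, fun s hs => ⟨hN s hs, hζ s hs⟩, fun s => ⟨hblue s, ?_⟩⟩
  obtain h | h := le_total (R : ℤ) s
  · lift s to ℕ using by omega
    have hs : R ≤ s := by exact_mod_cast h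
    have h1 := hζ (s + 1) (by omega)
    push_cast at h1
    rw [hN s hs, hζ s hs, h1]
    exact (isTailPath s).2
  · induction s, h using Int.leInductionDown with
    | base =>
      have h1 := hζ (R + 1) (by omega)
      push_cast at h1
      rw [hN R le_rfl, hζ R le_rfl, h1]
      exact (isTailPath R).2
    | pred s hs ih =>
      -- The relation between the blocks at the level `s` moves the red block past the blue one.
      have hp := hper (s - 1)
      rw [sub_add_cancel] at hp ⊢
      rw [← hblue s, hp.1, ← mul_smul, hT, mul_smul, ← hp.2, ih]
      simpa using hblue (s - 1)

theorem pos_bluePred [UniquePull θ (TailSpace T hT)] (x : TailSpace T hT) :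
    pos (bluePred θ x) = pos x - cls k l 1 0 := by
  have h := pos_smul (e θ (blueLabel θ x)) (bluePred θ x)
  rw [e_smul_bluePred, blueLen_e, redLen_e] at h
  rw [h]
  simp

theorem pos_redPred [UniquePull θ (TailSpace T hT)] (x : TailSpace T hT) :
    pos (redPred θ x) = pos x - cls k l 0 1 := by
  have h := pos_smul (f θ (redLabel θ x)) (redPred θ x)
  rw [f_smul_redPred, blueLen_f, redLen_f] at h
  rw [h]
  simp

/-- The corners, continued periodically, and their predecessors form a copy of `ℤ² / ℤ(k, -l)` in
the vertex space. -/
theorem exists_embedding [UniquePull θ (TailSpace T hT)] (hk : 0 < k) (hl : 0 < l) {R : ℕ}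
    (hR : T.Recurs R) :
    ∃ φ : SpiralGroup k l → TailSpace T hT, (∀ g, pos (φ g) = g) ∧
      (∀ g, bluePred θ (φ g) = φ (g - cls k l 1 0)) ∧
      (∀ g, redPred θ (φ g) = φ (g - cls k l 0 1)) ∧
      ∀ r : ℕ, R ≤ r → φ (cls k l (-(r * k)) 0) = mk hT 1 r := by
  obtain ⟨N, ζ, hζ, hblock⟩ := exists_corners (hT := hT) hR
  have hcomm := fun a c (x : TailSpace T hT) =>
    ((bluePred_redPred_comm (θ := θ) (X := TailSpace T hT)).iterate_iterate a c).eq x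
  have hblue : ∀ (c : ℕ) (s : ℤ), (bluePred θ)^[c * k] (ζ s) = ζ (s + c) := fun c s => by
    induction c with
    | zero => simp
    | succ c ih =>
      rw [add_mul, one_mul, add_comm, Function.iterate_add_apply, ih, ← (hblock (s + c)).1,
        bluePred_iterate_eWord_smul, add_assoc, Nat.cast_succ]
  have hred : ∀ (c : ℕ) (s : ℤ), (redPred θ)^[c * l] (ζ s) = ζ (s + c) := fun c s => by
    induction c with
    | zero => simp
    | succ c ih =>
      rw [add_mul, one_mul, add_comm, Function.iterate_add_apply, ih, ← (hblock (s + c)).2,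
        redPred_iterate_fWord_smul, add_assoc, Nat.cast_succ]
  let P : ℤ → ℕ → ℕ → TailSpace T hT := fun s a b => (bluePred θ)^[a] ((redPred θ)^[b] (ζ s))
  -- Different descriptions of an element of the group give the same vertex: first two
  -- descriptions with the same number of red steps, then the general case.
  have hP0 : ∀ {s s' : ℤ} {a a' b : ℕ}, s * k + a = s' * k + a' → P s a b = P s' a' b := by
    intro s s' a a' b h
    wlog hs : s ≤ s' generalizing s s' a a'
    · exact (this h.symm (le_of_not_ge hs)).symm
    obtain ⟨d, rfl⟩ := Int.le.dest hs
    have ha : a = a' + d * k := by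
      zify
      linarith
    simp only [P]
    rw [ha, Function.iterate_add_apply, hcomm (d * k), hblue]
  have hP : ∀ {s s' : ℤ} {a a' b b' : ℕ},
      cls k l (-(s * k) - a) (-b) = cls k l (-(s' * k) - a') (-b') → P s a b = P s' a' b' := by
    intro s s' a a' b b' h
    obtain ⟨c, h1, h2⟩ := cls_eq_cls.1 h
    wlog hc : 0 ≤ c generalizing s s' a a' b b' c
    · exact (this h.symm (-c) (by linarith) (by linarith) (by omega)).symm
    lift c to ℕ using hc
    have hb : b' = b + c * l := by
      zify
      linarith
    have h3 : P s' a' b' = P (s' + c) a' b := by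
      simp only [P]
      rw [hb, Function.iterate_add_apply, hred]
    rw [h3]
    exact hP0 (by linarith)
  have hex : ∀ g : SpiralGroup k l, ∃ x, ∃ (s : ℤ) (a b : ℕ),
      cls k l (-(s * k) - a) (-b) = g ∧ P s a b = x := by
    intro g
    obtain ⟨s, t, rfl⟩ := exists_cls g
    have hk' : (1 : ℤ) ≤ k := by exact_mod_cast hk
    have hl' : (1 : ℤ) ≤ l := by exact_mod_cast hl
    have ha : 0 ≤ |s| * k - s := by nlinarith [le_abs_self s, abs_nonneg s]
    have hb : 0 ≤ |t| * l - t := by nlinarith [le_abs_self t, abs_nonneg t]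
    refine ⟨_, -(|s| + |t|), (|s| * k - s).toNat, (|t| * l - t).toNat, ?_, rfl⟩
    rw [Int.toNat_of_nonneg ha, Int.toNat_of_nonneg hb]
    exact cls_eq_cls.2 ⟨-|t|, by ring, by ring⟩
  choose φ hφ using hex
  have hφP : ∀ (s : ℤ) (a b : ℕ), φ (cls k l (-(s * k) - a) (-b)) = P s a b := fun s a b => by
    obtain ⟨s', a', b', h, h'⟩ := hφ (cls k l (-(s * k) - a) (-b))
    rw [← h', hP h]
  have hposζ : ∀ s : ℤ, pos (ζ s) = cls k l (-(s * k)) 0 := fun s => by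
    have hup : ∀ r : ℕ, R ≤ r → pos (ζ r) = cls k l (-(r * k)) 0 := fun r hr => by
      rw [(hζ r hr).2, pos_mk]
      simp
    obtain h | h := le_total (R : ℤ) s
    · lift s to ℕ using by omega
      exact hup s (by exact_mod_cast h)
    · induction s, h using Int.leInductionDown with
      | base => exact hup R le_rfl
      | pred s hs ih =>
        have h1 := (hblock (s - 1)).1
        rw [sub_add_cancel] at h1
        rw [← h1, pos_smul, ih, cls_add, blueLen_eWord, redLen_eWord]
        congr 1
        ring
  have hposB : ∀ (a : ℕ) (x : TailSpace T hT),
      pos ((bluePred θ)^[a] x) = pos x - cls k l a 0 := fun a x => by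
    induction a with
    | zero => simp [cls_zero]
    | succ a ih => rw [Function.iterate_succ_apply', pos_bluePred, ih, sub_sub, cls_add]; simp
  have hposR : ∀ (a : ℕ) (x : TailSpace T hT),
      pos ((redPred θ)^[a] x) = pos x - cls k l 0 a := fun a x => by
    induction a with
    | zero => simp [cls_zero]
    | succ a ih => rw [Function.iterate_succ_apply', pos_redPred, ih, sub_sub, cls_add]; simp
  refine ⟨φ, fun g => ?_, fun g => ?_, fun g => ?_, fun r hr => ?_⟩
  · obtain ⟨s, a, b, rfl, h'⟩ := hφ g
    rw [← h']
    simp only [P]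
    rw [hposB, hposR, hposζ, cls_sub, cls_sub]
    congr 1 <;> ring
  · obtain ⟨s, a, b, rfl, h'⟩ := hφ g
    rw [← h']
    simp only [P]
    rw [← Function.iterate_succ_apply' (bluePred θ)]
    refine (hφP s (a + 1) b).symm.trans (congrArg φ ?_)
    rw [cls_sub]
    congr 1 <;> push_cast <;> ring
  · obtain ⟨s, a, b, rfl, h'⟩ := hφ g
    rw [← h']
    simp only [P]
    rw [hcomm, ← Function.iterate_succ_apply' (redPred θ), ← hcomm]
    refine (hφP s a (b + 1)).symm.trans (congrArg φ ?_)
    rw [cls_sub]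
    congr 1 <;> push_cast <;> ring
  · have h := hφP r 0 0
    simpa [P, (hζ r hr).2] using h

end TailSpace

/-! ### The group construction and its dilation -/

section GroupRep

open ContinuousLinearMap

theorem adjoint_ofFamily_ξ {G X : Type*} {φ : G → X}
    (hv : Orthonormal ℂ fun g => (ξ (φ g) : Ell2 X)) {x : X} (hx : x ∉ Set.range φ) :
    adjoint (ofFamily hv).toContinuousLinearMap (ξ x) = 0 := by
  refine (stdBasis G).repr.injective (lp.ext (funext fun g => ?_))
  rw [HilbertBasis.repr_apply_apply, adjoint_inner_right, stdBasis_apply,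
    LinearIsometry.coe_toContinuousLinearMap, ofFamily_ξ, orthonormal_ξ.2 fun h => hx ⟨g, h⟩,
    map_zero]
  rfl

theorem TailData.exists_recurs {m n k l : ℕ} (T : TailData m n k l) : ∃ R, T.Recurs R := by
  obtain ⟨a, b, hne, h⟩ := Finite.exists_ne_map_eq_of_infinite fun r => (T.u r, T.v r)
  rw [Prod.mk.injEq] at h
  obtain hab | hab := lt_or_gt_of_ne hne
  exacts [⟨a, b, hab, h.1.symm, h.2.symm⟩, ⟨b, a, hab, h.1, h.2⟩]

variable {m n : ℕ} {θ : Equiv.Perm (Fin m × Fin n)} {k l : ℕ} {T : TailData m n k l}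
variable {hT : T.Compatible θ} [UniquePull θ (TailSpace T hT)]

/-- The group construction that reads off the labels along a copy of `ℤ² / ℤ(k, -l)` in the vertex
space. -/
def groupOfEmbedding (φ : SpiralGroup k l → TailSpace T hT)
    (hb : ∀ g, bluePred θ (φ g) = φ (g - cls k l 1 0))
    (hr : ∀ g, redPred θ (φ g) = φ (g - cls k l 0 1)) (β₀ : Circle) :
    GroupConstruction θ (SpiralGroup k l) (cls k l 1 0) (cls k l 0 1) where
  generate := closure_cls
  i g := blueLabel θ (φ (g + cls k l 1 0))
  j g := redLabel θ (φ (g + cls k l 0 1))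
  α _ := 1
  β _ := β₀
  comm_labels g := by
    have h := label_comm (θ := θ) (φ (g + cls k l 0 1 + cls k l 1 0))
    rw [hb, add_sub_cancel_right, hr, add_right_comm, add_sub_cancel_right] at h
    rw [add_right_comm g, h]
  comm_scalars g := by rw [one_mul, mul_one]

variable {φ : SpiralGroup k l → TailSpace T hT}

/-- A copy of the group is closed under predecessors; hence the orthogonal complement of its span is
invariant. -/
theorem mem_range_of_smul_mem_range (hb : ∀ g, bluePred θ (φ g) = φ (g - cls k l 1 0))
    (hr : ∀ g, redPred θ (φ g) = φ (g - cls k l 0 1)) {w : Semi θ} {x : TailSpace T hT}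
    (h : w • x ∈ Set.range φ) : x ∈ Set.range φ := by
  induction w using Semi.induction with
  | one => rwa [one_smul] at h
  | e_mul i w ih =>
    obtain ⟨g, hg⟩ := h
    refine ih ⟨g - cls k l 1 0, ?_⟩
    rw [← hb, hg, mul_smul, bluePred_e_smul]
  | f_mul j w ih =>
    obtain ⟨g, hg⟩ := h
    refine ih ⟨g - cls k l 0 1, ?_⟩
    rw [← hr, hg, mul_smul, redPred_f_smul]

variable (hb : ∀ g, bluePred θ (φ g) = φ (g - cls k l 1 0))
  (hr : ∀ g, redPred θ (φ g) = φ (g - cls k l 0 1))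

theorem groupOfEmbedding_continues {R : ℕ} {β₀ : Circle} (hβ₀ : β₀ ^ l = T.β)
    (hφ : ∀ r : ℕ, R ≤ r → φ (cls k l (-(r * k)) 0) = TailSpace.mk hT 1 r) :
    Continues (groupOfEmbedding φ hb hr β₀) T R := by
  have hφ' : ∀ r : ℕ, R ≤ r → φ (cls k l 0 (-(r * l))) = TailSpace.mk hT 1 r := fun r h => by
    rw [← hφ r h]
    exact congrArg φ (cls_eq_cls.2 ⟨-r, by ring, by ring⟩)
  have hbi : ∀ (a : ℕ) (g : SpiralGroup k l),
      (bluePred θ)^[a] (φ g) = φ (g - cls k l a 0) := fun a g => by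
    induction a with
    | zero => simp [cls_zero]
    | succ a ih => rw [Function.iterate_succ_apply', ih, hb, sub_sub, cls_add]; simp
  have hri : ∀ (a : ℕ) (g : SpiralGroup k l),
      (redPred θ)^[a] (φ g) = φ (g - cls k l 0 a) := fun a g => by
    induction a with
    | zero => simp [cls_zero]
    | succ a ih => rw [Function.iterate_succ_apply', ih, hr, sub_sub, cls_add]; simp
  refine ⟨fun _ => rfl, ⟨β₀, hβ₀, fun _ => rfl⟩, fun r h a => ?_, fun r h a => ?_⟩
  · have h1 := blueLabel_iterate_eWord_smul (θ := θ) (T.u r) (TailSpace.mk hT 1 (r + 1)) a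
    have h2 : eWord θ (T.u r) • TailSpace.mk hT 1 (r + 1) = TailSpace.mk hT 1 r :=
      (TailSpace.isTailPath r).1
    rw [h2, ← hφ r h, hbi, cls_sub] at h1
    rw [← h1]
    change blueLabel θ (φ (_ + _)) = _
    rw [cls_add]
    congr 3
    ring
  · have h1 := redLabel_iterate_fWord_smul (θ := θ) (T.v r) (TailSpace.mk hT 1 (r + 1)) a
    have h2 : fWord θ (T.v r) • TailSpace.mk hT 1 (r + 1) = TailSpace.mk hT 1 r :=
      (TailSpace.isTailPath r).2
    rw [h2, ← hφ' r h, hri, cls_sub] at h1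
    rw [← h1]
    change redLabel θ (φ (_ + _)) = _
    rw [cls_add]
    congr 3
    ring

/-- The compression of the standard representation to a copy of `ℤ² / ℤ(k, -l)` is a group
construction representation, and the standard representation is its minimal isometric dilation. -/
theorem exists_group_rep {β₀ : Circle} (hinj : Function.Injective φ) {R : ℕ}
    (hφ : ∀ r : ℕ, R ≤ r → φ (cls k l (-(r * k)) 0) = TailSpace.mk hT 1 r) :
    ∃ (σ : Semi θ →* (Ell2 (SpiralGroup k l) →L[ℂ] Ell2 (SpiralGroup k l)))
      (V : Ell2 (SpiralGroup k l) →ₗᵢ[ℂ] Ell2 (TailSpace T hT)),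
      (groupOfEmbedding φ hb hr β₀).IsRep σ ∧ IsDefectFree σ ∧
        IsMinimalIsometricDilation σ (actionRep θ (TailSpace T hT) β₀) V := by
  have hv : Orthonormal ℂ fun g => (ξ (φ g) : Ell2 (TailSpace T hT)) :=
    orthonormal_ξ.comp φ hinj
  let V := ofFamily hv
  have hVξ : ∀ g, V (ξ g) = ξ (φ g) := ofFamily_ξ hv
  have hV1 : ∀ g, adjoint V.toContinuousLinearMap (ξ (φ g)) = ξ g := fun g => by
    rw [← hVξ, adjoint_comp_isometry]
  have hV0 : ∀ x, x ∉ Set.range φ → adjoint V.toContinuousLinearMap (ξ x) = 0 := fun x hx =>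
    adjoint_ofFamily_ξ hv hx
  set π := actionRep θ (TailSpace T hT) β₀ with hπ
  have hco : ∀ w y, adjoint V.toContinuousLinearMap
      (π w (V (adjoint V.toContinuousLinearMap y))) =
      adjoint V.toContinuousLinearMap (π w y) := fun w y => by
    have h : adjoint V.toContinuousLinearMap ∘L π w ∘L V.toContinuousLinearMap ∘L
        adjoint V.toContinuousLinearMap = adjoint V.toContinuousLinearMap ∘L π w := by
      refine ext_ξ fun x => ?_
      simp only [comp_apply, LinearIsometry.coe_toContinuousLinearMap]
      by_cases hx : x ∈ Set.range φ
      · obtain ⟨g, rfl⟩ := hx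
        rw [hV1, hVξ]
      · rw [hV0 x hx, map_zero, map_zero, map_zero, hπ, actionRep_ξ, map_smul,
          hV0 _ fun h => hx (mem_range_of_smul_mem_range hb hr h), smul_zero]
    exact congrArg (fun A : Ell2 (TailSpace T hT) →L[ℂ] Ell2 (SpiralGroup k l) => A y) h
  have hstar : IsStarRep π := actionRep_isStarRep
  refine ⟨compression π V hco, V, ⟨fun i g => ?_, fun j g => ?_⟩,
    ⟨compression_sum hco hstar.2.1, compression_sum hco hstar.2.2⟩,
    hstar.1, fun w => rfl, ?_⟩
  · rw [compression_apply, hVξ, hπ, actionRep_ξ, redLen_e, pow_zero, one_smul]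
    have hpred : bluePred θ (φ (g + cls k l 1 0)) = φ g := by rw [hb, add_sub_cancel_right]
    split_ifs with h
    · have h' : e θ i • φ g = φ (g + cls k l 1 0) := by
        rw [h, ← hpred]
        exact e_smul_bluePred _
      rw [h', hV1]
      simp [groupOfEmbedding]
    · refine hV0 _ ?_
      rintro ⟨g', hg'⟩
      have h1 : φ (g' - cls k l 1 0) = φ g := by rw [← hb, hg', bluePred_e_smul]
      refine h ?_
      change i = blueLabel θ (φ (g + cls k l 1 0))
      rw [← hinj h1, sub_add_cancel, hg', blueLabel_e_smul]
  · rw [compression_apply, hVξ, hπ, actionRep_ξ, redLen_f, pow_one, map_smul]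
    have hpred : redPred θ (φ (g + cls k l 0 1)) = φ g := by rw [hr, add_sub_cancel_right]
    split_ifs with h
    · have h' : f θ j • φ g = φ (g + cls k l 0 1) := by
        rw [h, ← hpred]
        exact f_smul_redPred _
      rw [h', hV1]
      rfl
    · rw [hV0, smul_zero]
      rintro ⟨g', hg'⟩
      have h1 : φ (g' - cls k l 0 1) = φ g := by rw [← hr, hg', redPred_f_smul]
      refine h ?_
      change j = redLabel θ (φ (g + cls k l 0 1))
      rw [← hinj h1, sub_add_cancel, hg', redLabel_f_smul]
  · rw [eq_top_iff, ← (stdBasis (TailSpace T hT)).dense_span]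
    refine Submodule.topologicalClosure_mono (Submodule.span_le.2 ?_)
    rintro _ ⟨x, rfl⟩
    -- Every vertex is reached from a corner so deep that it lies in the copy of the group.
    obtain ⟨w, r, rfl⟩ := TailSpace.exists_rep x
    obtain ⟨p, hp, -, -⟩ := BlockPath.exists_blue (θ := θ) (T := T) r R
    have h1 : ξ (TailSpace.mk hT w r) = ((β₀ : ℂ) ^ redLen (w * p))⁻¹ •
        π (w * p) (V (ξ (cls k l (-((r + R : ℕ) * k)) 0))) := by
      rw [hVξ, hφ _ (Nat.le_add_left R r), hπ, actionRep_ξ, smul_smul, inv_mul_cancel₀, one_smul,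
        TailSpace.smul_mk, mul_one, TailSpace.mk_mul hp]
      exact pow_ne_zero _ (Circle.coe_ne_zero _)
    rw [stdBasis_apply, h1]
    exact Submodule.smul_mem _ _ (Submodule.subset_span ⟨_, _, rfl⟩)

end GroupRep

end RankTwo

end

theorem lemmaL {m n : ℕ} (θ : Equiv.Perm (Fin m × Fin n)) :
    -- every representation of type 3bii has tail data, which are unique at a given vertex
    (∀ {H : Type*} [NormedAddCommGroup H] [InnerProductSpace ℂ H] [CompleteSpace H] {ι : Type*}
      (π : RankTwo.Semi θ →* (H →L[ℂ] H)) (b : HilbertBasis ι ℂ H), RankTwo.IsType3bii π b →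
      ∀ (k l : ℕ) (x : ι), RankTwo.ReturnsAbove π b k l x →
        ∃ T : RankTwo.TailData m n k l, RankTwo.HasTailData π b x T ∧ T.Compatible θ ∧
          ∀ T' : RankTwo.TailData m n k l, RankTwo.HasTailData π b x T' → T' = T) ∧
    -- the data determine the representation up to unitary equivalence
    (∀ {H₁ : Type*} [NormedAddCommGroup H₁] [InnerProductSpace ℂ H₁] [CompleteSpace H₁]
      {H₂ : Type*} [NormedAddCommGroup H₂] [InnerProductSpace ℂ H₂] [CompleteSpace H₂]
      {ι₁ ι₂ : Type*}
      (π₁ : RankTwo.Semi θ →* (H₁ →L[ℂ] H₁)) (b₁ : HilbertBasis ι₁ ℂ H₁)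
      (π₂ : RankTwo.Semi θ →* (H₂ →L[ℂ] H₂)) (b₂ : HilbertBasis ι₂ ℂ H₂),
      RankTwo.IsType3bii π₁ b₁ → RankTwo.IsType3bii π₂ b₂ →
      ∀ (k l : ℕ) (T : RankTwo.TailData m n k l) (x₁ : ι₁) (x₂ : ι₂),
        RankTwo.HasTailData π₁ b₁ x₁ T → RankTwo.HasTailData π₂ b₂ x₂ T →
          RankTwo.UnitarilyEquivalent π₁ π₂) ∧
    -- conversely, all compatible data come from a group construction on `ℤ² / ℤ(k, -l)`
    (∀ (k l : ℕ), 0 < k → 0 < l → ∀ T : RankTwo.TailData m n k l, T.Compatible θ →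
      (∃ R, T.Recurs R) ∧
      ∀ R, T.Recurs R →
        ∃ (D : RankTwo.GroupConstruction θ (RankTwo.SpiralGroup k l)
            (RankTwo.cls k l 1 0) (RankTwo.cls k l 0 1))
          (σ : RankTwo.Semi θ →*
            (RankTwo.Ell2 (RankTwo.SpiralGroup k l) →L[ℂ]
              RankTwo.Ell2 (RankTwo.SpiralGroup k l))),
          RankTwo.Continues D T R ∧ D.IsRep σ ∧ RankTwo.IsDefectFree σ ∧
          ∃ (X : Type) (π : RankTwo.Semi θ →* (RankTwo.Ell2 X →L[ℂ] RankTwo.Ell2 X))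
            (b : HilbertBasis X ℂ (RankTwo.Ell2 X))
            (V : RankTwo.Ell2 (RankTwo.SpiralGroup k l) →ₗᵢ[ℂ] RankTwo.Ell2 X) (x : X),
            RankTwo.IsMinimalIsometricDilation σ π V ∧ RankTwo.IsType3bii π b ∧
              RankTwo.HasTailData π b x T) := by
  refine ⟨?_, ?_, ?_⟩
  · intro H _ _ _ ι π b hπ k l x hx
    obtain ⟨_, _, hA⟩ := RankTwo.exists_vertex_action hπ.starRep hπ.atomic
    obtain ⟨T, hT, hc⟩ := hA.exists_tailData hx
    exact ⟨T, hT, hc, fun T' hT' => hA.tailData_unique hT hT'⟩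
  · intro H₁ _ _ _ H₂ _ _ _ ι₁ ι₂ π₁ b₁ π₂ b₂ h₁ h₂ k l T x₁ x₂ hT₁ hT₂
    have hl : 0 < l := hT₁.1.2.1.1.1
    obtain ⟨β₀, hβ₀⟩ := RankTwo.exists_circle_root hl T.β
    obtain ⟨_, b₁', h₁'⟩ := h₁.exists_tail_basis hT₁ hl hβ₀
    obtain ⟨_, b₂', h₂'⟩ := h₂.exists_tail_basis hT₂ hl hβ₀
    exact RankTwo.unitarilyEquivalent_of_basis b₁' b₂' _ h₁' h₂'
  · intro k l hk hl T hT
    refine ⟨T.exists_recurs, fun R hR => ?_⟩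
    have := RankTwo.TailSpace.uniquePull (hT := hT) hk hl
    obtain ⟨β₀, hβ₀⟩ := RankTwo.exists_circle_root hl T.β
    obtain ⟨φ, hpos, hb, hr, hφ⟩ := RankTwo.TailSpace.exists_embedding (hT := hT) hk hl hR
    obtain ⟨σ, V, hσ, hdf, hdil⟩ := RankTwo.exists_group_rep (β₀ := β₀) hb hr
      (Function.LeftInverse.injective hpos) hφ
    exact ⟨_, σ, RankTwo.groupOfEmbedding_continues hb hr hβ₀ hφ, hσ, hdf, _, _,
      RankTwo.stdBasis _, V, _, hdil, RankTwo.TailSpace.isType3bii hk hl β₀,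
      RankTwo.TailSpace.hasTailData hk hl hβ₀⟩
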